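/- Let $d\ge 1$ be an integer, $a<b$ real, $P_0,P_1\in\mathbb{C}^{d\times d}$ with $P_0^\star=-P_0$ and $P_1^\star=P_1$ invertible. Let $\mathcal{H}\colon(a,b)\to\mathbb{C}^{d\times d}$ be measurable such that there are $0<m\le M$ for which, for almost every $\xi\in(a,b)$, $\mathcal{H}(\xi)$ is self-adjoint and $m|\zeta|^2\le\langle\mathcal{H}(\xi)\zeta,\zeta\rangle_{\mathbb{C}^d}\le M|\zeta|^2$ for all $\zeta\in\mathbb{C}^d$. Write $(\mathcal{H}x)(\xi)=\mathcal{H}(\xi)x(\xi)$, let $X$ be the space $L^2(a,b;\mathbb{C}^d)$ endowed with the inner product $\langle x,y\rangle_X=\langle\mathcal{H}x,y\rangle_{L^2}$, and let $H^1$ be the space of absolutely continuous $y\colon[a,b]\to\mathbb{C}^d$ with $y'\in L^2(a,b;\mathbb{C}^d)$. Define $$A_0x=P_0\mathcal{H}x+P_1(\mathcal{H}x)'\quad\text{for } x\in D(A_0)=\{x\in X : \mathcal{H}x\in H^1,\ (\mathcal{H}x)(a)=(\mathcal{H}x)(b)=0\},$$ $$\Gamma_1y=\tfrac{1}{\sqrt2}P_1(y(b)-y(a)),\qquad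 \Gamma_2y=\tfrac1{\sqrt2}(y(b)+y(a))\qquad(y\in H^1).$$ (i) If $W\in\mathbb{C}^{d\times 2d}$ satisfies $\operatorname{rk}W=d$ and $W\Sigma W^\star\ge0$ (positive semidefinite), where $\Sigma=\bigl[\begin{smallmatrix}0&I\\I&0\end{smallmatrix}\bigr]\in\mathbb{C}^{2d\times 2d}$, then the operator $B_0$ in $X$ defined by $$B_0x=P_0\mathcal{H}x+P_1(\mathcal{H}x)'\quad\text{for } x\in D(B_0)=\Bigl\{x\in X : \mathcal{H}x\in H^1,\ W\begin{bmatrix}\Gamma_1\mathcal{H}x\\ \Gamma_2\mathcal{H}x\end{bmatrix}=0\Bigr\}$$ extends $A_0$ and generates a $C_0$-semigroup of contractions on $X$. (ii) Conversely, every linear operator $B_0\colon D(B_0)\to X$, $D(B_0)\subseteq X$, that extends $A_0$ and generates a $C_0$-semigroup of contractions on $X$ is of the form in (i) for some $W\in\mathbb{C}^{d\times 2d}$ with $\operatorname{rk}W=d$ and $W\Sigma W^\star\ge0$. -/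

import Mathlib

open MeasureTheory Filter Topology Set
open scoped Matrix NNReal ENNReal InnerProductSpace ComplexOrder

noncomputable section

namespace PHS

/-! ### Semigroups and generators -/

/-- `T` is a `C₀`-semigroup of contractions on `X`. -/
structure IsContractionC0Semigroup {X : Type*} [NormedAddCommGroup X] [NormedSpace ℂ X]
    (T : ℝ≥0 → X →L[ℂ] X) : Prop where
  map_zero : T 0 = 1
  map_add : ∀ s t, T (s + t) = T s * T t
  tendsto_zero : ∀ x, Tendsto (fun t => T t x) (𝓝 0) (𝓝 x)
  norm_le_one : ∀ t, ‖T t‖ ≤ 1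

/-- `B` is the (infinitesimal) generator of `T`: one has `x ∈ D(B)` and `B x = z` if and only if
the difference quotients `(T t x - x) / t` tend to `z` as `t → 0+`. -/
def IsGenerator {X : Type*} [NormedAddCommGroup X] [NormedSpace ℂ X]
    (B : X →ₗ.[ℂ] X) (T : ℝ≥0 → X →L[ℂ] X) : Prop :=
  ∀ x z : X, (x, z) ∈ B.graph ↔
    Tendsto (fun t : ℝ≥0 => ((t : ℝ) : ℂ)⁻¹ • (T t x - x)) (𝓝[>] 0) (𝓝 z)

/-- The operator `B` generates a `C₀`-semigroup of contractions. -/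
def GeneratesContractionSemigroup {X : Type*} [NormedAddCommGroup X] [NormedSpace ℂ X]
    (B : X →ₗ.[ℂ] X) : Prop :=
  ∃ T : ℝ≥0 → X →L[ℂ] X, IsContractionC0Semigroup T ∧ IsGenerator B T

/-! ### The spaces `L²(a,b;ℂᵈ)` and `H¹(a,b;ℂᵈ)` -/

/-- The Euclidean space `ℂᵈ`. -/
abbrev Vec (d : ℕ) : Type := EuclideanSpace ℂ (Fin d)

/-- Lebesgue measure on `(a,b)`. -/
abbrev vol (a b : ℝ) : Measure ℝ := volume.restrict (Ioo a b)

/-- `L²(a,b;ℂᵈ)`. -/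
abbrev L2 (d : ℕ) (a b : ℝ) : Type := Lp (Vec d) 2 (vol a b)

lemma ac_memLp {d : ℕ} {a b : ℝ} {y : ℝ → Vec d} (hy : AbsolutelyContinuousOnInterval y a b) :
    MemLp y 2 (vol a b) := by
  have hsub : Ioo a b ⊆ uIcc a b := Ioo_subset_Icc_self.trans Icc_subset_uIcc
  obtain ⟨C, hC⟩ := hy.exists_bound
  refine MemLp.of_bound ((hy.continuousOn.mono hsub).aestronglyMeasurable measurableSet_Ioo) C ?_
  filter_upwards [ae_restrict_mem measurableSet_Ioo] with ξ hξ using hC ξ (hsub hξ)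

lemma ac_ae_differentiableAt {d : ℕ} {a b : ℝ} {y : ℝ → Vec d}
    (hy : AbsolutelyContinuousOnInterval y a b) :
    ∀ᵐ ξ ∂vol a b, DifferentiableAt ℝ y ξ := by
  have hsub : Ioo a b ⊆ uIcc a b := Ioo_subset_Icc_self.trans Icc_subset_uIcc
  rw [ae_restrict_iff' measurableSet_Ioo]
  filter_upwards [hy.boundedVariationOn.ae_differentiableAt_of_mem_uIcc] with ξ h hξ
    using h (hsub hξ)

lemma ac_deriv_add {d : ℕ} {a b : ℝ} {y z : ℝ → Vec d}
    (hy : AbsolutelyContinuousOnInterval y a b) (hz : AbsolutelyContinuousOnInterval z a b) :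
    deriv (y + z) =ᵐ[vol a b] deriv y + deriv z := by
  filter_upwards [ac_ae_differentiableAt hy, ac_ae_differentiableAt hz] with ξ h₁ h₂
  rw [deriv_add h₁ h₂, Pi.add_apply]

lemma ac_deriv_smul {d : ℕ} {a b : ℝ} {y : ℝ → Vec d} (c : ℂ)
    (hy : AbsolutelyContinuousOnInterval y a b) :
    deriv (c • y) =ᵐ[vol a b] c • deriv y := by
  filter_upwards [ac_ae_differentiableAt hy] with ξ h₁
  rw [deriv_const_smul c h₁, Pi.smul_apply]

/-- The Sobolev space `H¹(a,b;ℂᵈ)`: functions that are absolutely continuous on `[a,b]` with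
derivative (which exists almost everywhere) in `L²`.  Members are represented by functions on `ℝ`
whose values outside `[a,b]` play no role. -/
def H1 (d : ℕ) (a b : ℝ) : Submodule ℂ (ℝ → Vec d) where
  carrier := {y | AbsolutelyContinuousOnInterval y a b ∧ MemLp (deriv y) 2 (vol a b)}
  add_mem' := fun {_ _} hy hz => ⟨hy.1.add hz.1,
    (memLp_congr_ae (ac_deriv_add hy.1 hz.1)).2 (hy.2.add hz.2)⟩
  zero_mem' := by
    have h : deriv (0 : ℝ → Vec d) = 0 := by ext1 x; exact deriv_const x 0
    refine ⟨?_, ?_⟩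
    · exact (LipschitzWith.const (0 : Vec d)).lipschitzOnWith.absolutelyContinuousOnInterval
    · rw [h]; exact MemLp.zero
  smul_mem' := fun c _ hy => ⟨hy.1.const_smul c,
    (memLp_congr_ae (ac_deriv_smul c hy.1)).2 (hy.2.const_smul c)⟩

/-- The inclusion `H¹ → L²`. -/
def H1.toL2 (d : ℕ) (a b : ℝ) : H1 d a b →ₗ[ℂ] L2 d a b where
  toFun y := (ac_memLp y.2.1).toLp y.1
  map_add' _ _ := MemLp.toLp_add _ _
  map_smul' c _ := MemLp.toLp_const_smul c _

/-- The derivative `H¹ → L²`, `y ↦ y'`. -/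
def H1.derivL2 (d : ℕ) (a b : ℝ) : H1 d a b →ₗ[ℂ] L2 d a b where
  toFun y := y.2.2.toLp (deriv y.1)
  map_add' y z := by
    rw [← MemLp.toLp_add y.2.2 z.2.2]
    exact MemLp.toLp_congr _ _ (ac_deriv_add y.2.1 z.2.1)
  map_smul' c y := by
    rw [RingHom.id_apply, ← MemLp.toLp_const_smul c y.2.2]
    exact MemLp.toLp_congr _ _ (ac_deriv_smul c y.2.1)

/-- An `L²`-class determines the derivative of its absolutely continuous representatives. -/
lemma H1.derivL2_eq {d : ℕ} {a b : ℝ} {y z : H1 d a b}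
    (h : H1.toL2 d a b y = H1.toL2 d a b z) : H1.derivL2 d a b y = H1.derivL2 d a b z := by
  have hsub : Ioo a b ⊆ uIcc a b := Ioo_subset_Icc_self.trans Icc_subset_uIcc
  have hae : y.1 =ᵐ[vol a b] z.1 := 
    (MemLp.toLp_eq_toLp_iff (ac_memLp y.2.1) (ac_memLp z.2.1)).1 h
  have heq : EqOn y.1 z.1 (Ioo a b) := Measure.eqOn_open_of_ae_eq hae isOpen_Ioo
    (y.2.1.continuousOn.mono hsub) (z.2.1.continuousOn.mono hsub)
  refine MemLp.toLp_congr y.2.2 z.2.2 ?_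
  filter_upwards [ae_restrict_mem measurableSet_Ioo] with ξ hξ
  exact (heq.eventuallyEq_of_mem (isOpen_Ioo.mem_nhds hξ)).deriv_eq

/-! ### The energy density `ℋ` and the energy space `X` -/

/-- A measurable `ℋ : (a,b) → ℂ^{d×d}` for which there are `0 < m ≤ M` such that, for almost every
`ξ ∈ (a,b)`, the matrix `ℋ(ξ)` is self-adjoint and `m|ζ|² ≤ ⟨ℋ(ξ)ζ,ζ⟩ ≤ M|ζ|²` for all `ζ ∈ ℂᵈ`.
(Values outside `(a,b)` play no role.) -/
structure EnergyDensity (d : ℕ) (a b : ℝ) where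
  toFun : ℝ → Matrix (Fin d) (Fin d) ℂ
  measurable_entries : ∀ i j, AEMeasurable (fun ξ => toFun ξ i j) (vol a b)
  bounds : ∃ m M : ℝ, 0 < m ∧ m ≤ M ∧ ∀ᵐ ξ ∂vol a b, (toFun ξ).IsHermitian ∧
    ∀ ζ : Vec d,
      m * ‖ζ‖ ^ 2 ≤ (⟪ζ, Matrix.toEuclideanCLM (𝕜 := ℂ) (toFun ξ) ζ⟫_ℂ).re ∧
      (⟪ζ, Matrix.toEuclideanCLM (𝕜 := ℂ) (toFun ξ) ζ⟫_ℂ).re ≤ M * ‖ζ‖ ^ 2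

variable {d : ℕ} {a b : ℝ}

lemma EnergyDensity.aestronglyMeasurable (ℋ : EnergyDensity d a b) {f : ℝ → Vec d}
    (hf : AEStronglyMeasurable f (vol a b)) :
    AEStronglyMeasurable (fun ξ => Matrix.toEuclideanCLM (𝕜 := ℂ) (ℋ.toFun ξ) (f ξ))
      (vol a b) := by
  refine AEMeasurable.aestronglyMeasurable ?_
  have hc : ∀ j, AEMeasurable (fun ξ => (f ξ) j) (vol a b) := fun j =>
    (EuclideanSpace.proj (𝕜 := ℂ) j).continuous.measurable.comp_aemeasurable hf.aemeasurable
  have h : AEMeasurable (fun ξ => fun i => ∑ j, ℋ.toFun ξ i j * (f ξ) j) (vol a b) :=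
    aemeasurable_pi_lambda _ fun i =>
      Finset.aemeasurable_fun_sum _ fun j _ => (ℋ.measurable_entries i j).mul (hc j)
  exact (PiLp.continuous_toLp 2 (fun _ : Fin d => ℂ)).measurable.comp_aemeasurable h

lemma opNorm_le_of_bounds {T : Vec d →L[ℂ] Vec d} (hT : (T : Vec d →ₗ[ℂ] Vec d).IsSymmetric)
    {M : ℝ} (hM : 0 ≤ M) (h0 : ∀ ζ, 0 ≤ (⟪ζ, T ζ⟫_ℂ).re) (h1 : ∀ ζ, (⟪ζ, T ζ⟫_ℂ).re ≤ M * ‖ζ‖ ^ 2) :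
    ‖T‖ ≤ M := by
  rw [ContinuousLinearMap.norm_eq_iSup_rayleighQuotient T hT]
  refine ciSup_le fun ζ => ?_
  have h : T.reApplyInnerSelf ζ = (⟪ζ, T ζ⟫_ℂ).re := by
    rw [ContinuousLinearMap.reApplyInnerSelf_apply, inner_re_symm]; rfl
  rw [ContinuousLinearMap.rayleighQuotient, h,
    abs_of_nonneg (div_nonneg (h0 ζ) (by positivity))]
  exact div_le_of_le_mul₀ (by positivity) hM (h1 ζ)

lemma EnergyDensity.norm_le (ℋ : EnergyDensity d a b) :
    ∃ M : ℝ, ∀ᵐ ξ ∂vol a b, ‖Matrix.toEuclideanCLM (𝕜 := ℂ) (ℋ.toFun ξ)‖ ≤ M := by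
  obtain ⟨m, M, hm, hmM, h⟩ := ℋ.bounds
  refine ⟨M, ?_⟩
  filter_upwards [h] with ξ hξ
  have hs : (Matrix.toEuclideanCLM (𝕜 := ℂ) (ℋ.toFun ξ) : Vec d →ₗ[ℂ] Vec d).IsSymmetric := by
    rw [Matrix.coe_toEuclideanCLM_eq_toEuclideanLin]
    exact Matrix.isSymmetric_toEuclideanLin_iff.2 hξ.1
  have h0 : ∀ ζ : Vec d, 0 ≤ m * ‖ζ‖ ^ 2 := fun ζ => by positivity
  exact opNorm_le_of_bounds hs (hm.le.trans hmM)
    (fun ζ => (h0 ζ).trans (hξ.2 ζ).1) (fun ζ => (hξ.2 ζ).2)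

lemma EnergyDensity.memLp (ℋ : EnergyDensity d a b) {f : ℝ → Vec d} (hf : MemLp f 2 (vol a b)) :
    MemLp (fun ξ => Matrix.toEuclideanCLM (𝕜 := ℂ) (ℋ.toFun ξ) (f ξ)) 2 (vol a b) := by
  obtain ⟨M, hM⟩ := ℋ.norm_le
  refine hf.of_le_mul (c := M) (ℋ.aestronglyMeasurable hf.1) ?_
  filter_upwards [hM] with ξ hξ
  exact (ContinuousLinearMap.le_opNorm _ _).trans (by gcongr)

/-- The multiplication operator `(ℋx)(ξ) = ℋ(ξ)x(ξ)` on `L²`. -/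
def EnergyDensity.mulL2 (ℋ : EnergyDensity d a b) : L2 d a b →ₗ[ℂ] L2 d a b where
  toFun x := (ℋ.memLp (Lp.memLp x)).toLp _
  map_add' x y := by
    rw [← MemLp.toLp_add]
    refine MemLp.toLp_congr _ _ ?_
    filter_upwards [Lp.coeFn_add x y] with ξ hξ
    rw [hξ, Pi.add_apply, map_add, Pi.add_apply]
  map_smul' c x := by
    rw [RingHom.id_apply, ← MemLp.toLp_const_smul]
    refine MemLp.toLp_congr _ _ ?_
    filter_upwards [Lp.coeFn_smul c x] with ξ hξ
    rw [hξ, Pi.smul_apply, map_smul, Pi.smul_apply]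

lemma EnergyDensity.coeFn_mulL2 (ℋ : EnergyDensity d a b) (x : L2 d a b) :
    ℋ.mulL2 x =ᵐ[vol a b] fun ξ => Matrix.toEuclideanCLM (𝕜 := ℂ) (ℋ.toFun ξ) (x ξ) :=
  MemLp.coeFn_toLp (ℋ.memLp (Lp.memLp x))

lemma EnergyDensity.inner_mulL2 (ℋ : EnergyDensity d a b) (x y : L2 d a b) :
    ⟪ℋ.mulL2 x, y⟫_ℂ = ⟪x, ℋ.mulL2 y⟫_ℂ := by
  obtain ⟨m, M, hm, hmM, h⟩ := ℋ.bounds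
  rw [L2.inner_def, L2.inner_def]
  refine integral_congr_ae ?_
  filter_upwards [h, ℋ.coeFn_mulL2 x, ℋ.coeFn_mulL2 y] with ξ hξ h1 h2
  rw [h1, h2]
  exact Matrix.isSymmetric_toEuclideanLin_iff.2 hξ.1 (x ξ) (y ξ)

lemma EnergyDensity.coercive (ℋ : EnergyDensity d a b) :
    ∃ m : ℝ, 0 < m ∧ ∀ x : L2 d a b, m * ‖x‖ ^ 2 ≤ (⟪x, ℋ.mulL2 x⟫_ℂ).re := by
  obtain ⟨m, M, hm, hmM, h⟩ := ℋ.bounds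
  refine ⟨m, hm, fun x => ?_⟩
  have hx : ‖x‖ ^ 2 = ∫ ξ, ‖x ξ‖ ^ 2 ∂vol a b := by
    have := congrArg Complex.re (L2.inner_def (𝕜 := ℂ) x x)
    rw [inner_self_eq_norm_sq_to_K] at this
    have h2 : ∀ ξ, ⟪x ξ, x ξ⟫_ℂ = ((‖x ξ‖ ^ 2 : ℝ) : ℂ) := fun ξ => by
      rw [inner_self_eq_norm_sq_to_K]; norm_cast
    simp_rw [h2] at this
    rw [integral_complex_ofReal, Complex.ofReal_re] at this
    rw [← this]
    norm_cast
  have hre : (⟪x, ℋ.mulL2 x⟫_ℂ).re = ∫ ξ, (⟪x ξ, ℋ.mulL2 x ξ⟫_ℂ).re ∂vol a b := by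
    rw [L2.inner_def]
    exact (integral_re (L2.integrable_inner (𝕜 := ℂ) x (ℋ.mulL2 x))).symm
  rw [hx, hre, ← integral_const_mul]
  refine integral_mono_ae ?_ ?_ ?_
  · exact ((Lp.memLp x).integrable_norm_pow (by norm_num)).const_mul m
  · exact (L2.integrable_inner (𝕜 := ℂ) x (ℋ.mulL2 x)).re
  · filter_upwards [h, ℋ.coeFn_mulL2 x] with ξ hξ h1
    simp only [h1]
    exact (hξ.2 (x ξ)).1

/-- The energy space `X`: the vector space `L²(a,b;ℂᵈ)`, endowed below with the inner product
`⟨x,y⟩_X = ⟨ℋx,y⟩_{L²}`. -/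
def EnergySpace (_ℋ : EnergyDensity d a b) : Type := L2 d a b

instance (ℋ : EnergyDensity d a b) : AddCommGroup (EnergySpace ℋ) :=
  inferInstanceAs (AddCommGroup (L2 d a b))

instance (ℋ : EnergyDensity d a b) : Module ℂ (EnergySpace ℋ) :=
  inferInstanceAs (Module ℂ (L2 d a b))

/-- The identity map `X → L²`, as a linear equivalence. -/
def EnergySpace.toL2 (ℋ : EnergyDensity d a b) : EnergySpace ℋ ≃ₗ[ℂ] L2 d a b :=
  LinearEquiv.refl ℂ (L2 d a b)

/-- The energy inner product.  In Mathlib inner products are conjugate linear in the first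
argument, so `inner x y` is the number `⟨y,x⟩_X = ⟨ℋy,x⟩_{L²}` for inner products that are linear
in the first argument. -/
@[reducible] def EnergySpace.core (ℋ : EnergyDensity d a b) : InnerProductSpace.Core ℂ (EnergySpace ℋ) where
  inner x y := ⟪EnergySpace.toL2 ℋ x, ℋ.mulL2 (EnergySpace.toL2 ℋ y)⟫_ℂ
  conj_inner_symm x y := by rw [inner_conj_symm, ℋ.inner_mulL2]
  re_inner_nonneg x := by
    obtain ⟨m, hm, h⟩ := ℋ.coercive
    have h0 : 0 ≤ m * ‖EnergySpace.toL2 ℋ x‖ ^ 2 := by positivity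
    exact h0.trans (h _)
  add_left x y z := by rw [map_add, inner_add_left]
  smul_left x y r := by rw [map_smul, inner_smul_left]
  definite x hx := by
    obtain ⟨m, hm, h⟩ := ℋ.coercive
    have h1 := h (EnergySpace.toL2 ℋ x)
    rw [hx, Complex.zero_re] at h1
    have h2 : ‖EnergySpace.toL2 ℋ x‖ ^ 2 ≤ 0 := by
      by_contra hc
      exact absurd h1 (not_le.2 (mul_pos hm (not_le.1 hc)))
    have h3 : EnergySpace.toL2 ℋ x = 0 := by
      rw [← norm_eq_zero]
      exact pow_eq_zero_iff two_ne_zero |>.1 (le_antisymm h2 (by positivity))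
    simpa using h3

instance (ℋ : EnergyDensity d a b) : NormedAddCommGroup (EnergySpace ℋ) :=
  (EnergySpace.core ℋ).toNormedAddCommGroup

instance (ℋ : EnergyDensity d a b) : InnerProductSpace ℂ (EnergySpace ℋ) :=
  InnerProductSpace.ofCore (EnergySpace.core ℋ).toCore

lemma EnergySpace.inner_def (ℋ : EnergyDensity d a b) (x y : EnergySpace ℋ) :
    ⟪x, y⟫_ℂ = ⟪EnergySpace.toL2 ℋ x, ℋ.mulL2 (EnergySpace.toL2 ℋ y)⟫_ℂ := rfl

/-- The map `ℋ : X → L²`, `x ↦ ℋx`. -/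
def EnergySpace.mulH (ℋ : EnergyDensity d a b) : EnergySpace ℋ →ₗ[ℂ] L2 d a b :=
  ℋ.mulL2 ∘ₗ (EnergySpace.toL2 ℋ).toLinearMap

/-! ### The port-Hamiltonian operators -/

/-- The differential expression `y ↦ P₀ y + P₁ y'` from `H¹` to `L²`. -/
def diffExpr (P₀ P₁ : Matrix (Fin d) (Fin d) ℂ) : H1 d a b →ₗ[ℂ] L2 d a b :=
  ((Matrix.toEuclideanCLM (𝕜 := ℂ) P₀).compLpL 2 (vol a b)).toLinearMap ∘ₗ H1.toL2 d a b +
  ((Matrix.toEuclideanCLM (𝕜 := ℂ) P₁).compLpL 2 (vol a b)).toLinearMap ∘ₗ H1.derivL2 d a b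

lemma diffExpr_eq (P₀ P₁ : Matrix (Fin d) (Fin d) ℂ) {y z : H1 d a b}
    (h : H1.toL2 d a b y = H1.toL2 d a b z) : diffExpr P₀ P₁ y = diffExpr P₀ P₁ z := by
  simp [diffExpr, h, H1.derivL2_eq h]

/-- The operator `x ↦ P₀ℋx + P₁(ℋx)'` in `X` with domain `{x ∈ X : ℋx ∈ V}`, where `V` is a
linear subspace of `H¹`. -/
def phOperator (P₀ P₁ : Matrix (Fin d) (Fin d) ℂ) (ℋ : EnergyDensity d a b)
    (V : Submodule ℂ (H1 d a b)) : EnergySpace ℋ →ₗ.[ℂ] EnergySpace ℋ where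
  domain := (V.map (H1.toL2 d a b)).comap (EnergySpace.mulH ℋ)
  toFun :=
    { toFun := fun x => (EnergySpace.toL2 ℋ).symm (diffExpr P₀ P₁ x.2.choose)
      map_add' := fun x y => by
        rw [← map_add, ← map_add]
        congr 1
        refine diffExpr_eq P₀ P₁ ?_
        rw [map_add, (x + y).2.choose_spec.2, x.2.choose_spec.2, y.2.choose_spec.2]
        exact map_add _ _ _
      map_smul' := fun c x => by
        rw [RingHom.id_apply, ← map_smul, ← map_smul]
        congr 1
        refine diffExpr_eq P₀ P₁ ?_
        rw [map_smul, (c • x).2.choose_spec.2, x.2.choose_spec.2]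
        exact map_smul _ _ _ }

lemma mem_phOperator_domain (P₀ P₁ : Matrix (Fin d) (Fin d) ℂ) (ℋ : EnergyDensity d a b)
    (V : Submodule ℂ (H1 d a b)) (x : EnergySpace ℋ) :
    x ∈ (phOperator P₀ P₁ ℋ V).domain ↔ ∃ y ∈ V, H1.toL2 d a b y = EnergySpace.mulH ℋ x :=
  Iff.rfl

/-- The value of the operator does not depend on the chosen representative `y` of `ℋx`. -/
lemma phOperator_apply (P₀ P₁ : Matrix (Fin d) (Fin d) ℂ) (ℋ : EnergyDensity d a b)
    (V : Submodule ℂ (H1 d a b)) (x : (phOperator P₀ P₁ ℋ V).domain) (y : H1 d a b)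
    (hy : H1.toL2 d a b y = EnergySpace.mulH ℋ x) :
    EnergySpace.toL2 ℋ (phOperator P₀ P₁ ℋ V x) = diffExpr P₀ P₁ y :=
  diffExpr_eq P₀ P₁ (x.2.choose_spec.2.trans hy.symm)

/-- `Γ₁ y = (1/√2) P₁ (y(b) - y(a))`. -/
def Γ₁ (P₁ : Matrix (Fin d) (Fin d) ℂ) : H1 d a b →ₗ[ℂ] (Fin d → ℂ) where
  toFun y := ((1 / √2 : ℝ) : ℂ) • (P₁ *ᵥ ((y.1 b).ofLp - (y.1 a).ofLp))
  map_add' y z := by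
    rw [← smul_add, ← Matrix.mulVec_add]
    congr 2
    simp only [Submodule.coe_add, Pi.add_apply, WithLp.ofLp_add]
    abel
  map_smul' c y := by
    rw [RingHom.id_apply, smul_comm c, ← Matrix.mulVec_smul P₁ c, smul_sub c]
    rfl

/-- `Γ₂ y = (1/√2) (y(b) + y(a))`. -/
def Γ₂ : H1 d a b →ₗ[ℂ] (Fin d → ℂ) where
  toFun y := ((1 / √2 : ℝ) : ℂ) • ((y.1 b).ofLp + (y.1 a).ofLp)
  map_add' y z := by
    rw [← smul_add]
    congr 1
    simp only [Submodule.coe_add, Pi.add_apply, WithLp.ofLp_add]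
    abel
  map_smul' c y := by
    rw [RingHom.id_apply, smul_comm c, smul_add c]
    rfl

/-- `{y ∈ H¹ : y(a) = y(b) = 0}`. -/
def zeroBoundary (d : ℕ) (a b : ℝ) : Submodule ℂ (H1 d a b) where
  carrier := {y | y.1 a = 0 ∧ y.1 b = 0}
  add_mem' := fun {y z} hy hz => ⟨by simp [hy.1, hz.1], by simp [hy.2, hz.2]⟩
  zero_mem' := ⟨rfl, rfl⟩
  smul_mem' := fun c y hy => ⟨by simp [hy.1], by simp [hy.2]⟩

/-- `{y ∈ H¹ : W (Γ₁ y, Γ₂ y)ᵀ = 0}` for a `d × 2d` matrix `W`. -/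
def boundaryCondition (P₁ : Matrix (Fin d) (Fin d) ℂ)
    (W : Matrix (Fin d) (Fin d ⊕ Fin d) ℂ) : Submodule ℂ (H1 d a b) where
  carrier := {y | W *ᵥ Sum.elim (Γ₁ P₁ y) (Γ₂ y) = 0}
  add_mem' := fun {y z} hy hz => by
    have h : Sum.elim (Γ₁ P₁ (y + z)) (Γ₂ (y + z)) =
        Sum.elim (Γ₁ P₁ y) (Γ₂ y) + Sum.elim (Γ₁ P₁ z) (Γ₂ z) := by
      ext (i | i) <;> simp
    rw [mem_ofPred_eq] at hy hz ⊢
    rw [h, Matrix.mulVec_add, hy, hz, add_zero]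
  zero_mem' := by
    have h : Sum.elim (Γ₁ P₁ (0 : H1 d a b)) (Γ₂ (0 : H1 d a b)) = 0 := by
      ext (i | i) <;> simp
    rw [mem_ofPred_eq, h, Matrix.mulVec_zero]
  smul_mem' := fun c y hy => by
    have h : Sum.elim (Γ₁ P₁ (c • y)) (Γ₂ (c • y)) = c • Sum.elim (Γ₁ P₁ y) (Γ₂ y) := by
      ext (i | i) <;> simp
    rw [mem_ofPred_eq] at hy ⊢
    rw [h, Matrix.mulVec_smul, hy, smul_zero]

/-- `A₀ x = P₀ℋx + P₁(ℋx)'` on `{x ∈ X : ℋx ∈ H¹, (ℋx)(a) = (ℋx)(b) = 0}`. -/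
def opA₀ (P₀ P₁ : Matrix (Fin d) (Fin d) ℂ) (ℋ : EnergyDensity d a b) :
    EnergySpace ℋ →ₗ.[ℂ] EnergySpace ℋ :=
  phOperator P₀ P₁ ℋ (zeroBoundary d a b)

/-- `B₀ x = P₀ℋx + P₁(ℋx)'` on `{x ∈ X : ℋx ∈ H¹, W (Γ₁ℋx, Γ₂ℋx)ᵀ = 0}`. -/
def opB₀ (P₀ P₁ : Matrix (Fin d) (Fin d) ℂ) (ℋ : EnergyDensity d a b)
    (W : Matrix (Fin d) (Fin d ⊕ Fin d) ℂ) : EnergySpace ℋ →ₗ.[ℂ] EnergySpace ℋ :=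
  phOperator P₀ P₁ ℋ (boundaryCondition P₁ W)

/-- The `2d × 2d` block matrix `Σ = [0 I; I 0]`. -/
def sigmaMatrix (d : ℕ) : Matrix (Fin d ⊕ Fin d) (Fin d ⊕ Fin d) ℂ :=
  Matrix.fromBlocks 0 1 1 0

/-- The admissible matrices: `W ∈ ℂ^{d×2d}` with `rk W = d` and `WΣW⋆ ≥ 0`. -/
def Admissible (W : Matrix (Fin d) (Fin d ⊕ Fin d) ℂ) : Prop :=
  W.rank = d ∧ (W * sigmaMatrix d * Wᴴ).PosSemidef

end PHS

end

/-! Call (x, z) a pair of the maximal operator if `ℋx` is represented by some y in `H1` and z = P₀y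
+ P₁y'. Since P₀ is skew-adjoint and P₁ self-adjoint, integration by parts turns ⟨z, x'⟩ + ⟨x, z'⟩
in the energy space into ⟨k, Σk'⟩, where k = (Γ₁y, Γ₂y) is the boundary vector (`IsRep.inner_add`).
As P₁ is invertible, every vector of ℂ²ᵈ is a boundary vector, and k = 0 exactly for y in
`zeroBoundary`. Pairs of the maximal operator are also recognised weakly, by testing against A₀
(`exists_isRep_of_weak`). What remains is linear algebra of the form Σ, whose signature is (d, d).

A condition k ∈ K is dissipative when Σ is nonpositive on K. Admissible matrices are those whose
kernel K is maximal with this property: WΣW⋆ is the form on the range of W⋆, which is the orthogonal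
complement of K, and Σ maps that complement onto the Σ-orthogonal complement of K
(`Admissible.nonpos`, `exists_admissible`).

For (i), the operator with K = ker W is closed and dissipative. A vector orthogonal to the range of
c - B₀ solves the adjoint problem, whose boundary vector is Σ-orthogonal to K; the sign of Σ there
forces the vector to vanish. Hence c - B₀ is onto, and the Lumer–Phillips theorem, proved by Yosida
approximation, applies.

For (ii), a generator B is dissipative and 1 - B is onto. Dissipativity makes an extension of A₀ a
restriction of the maximal operator, so B is determined by its space K of boundary vectors;
surjectivity makes K maximal, and W is built from the orthogonal complement of K. -/

section SemigroupTheory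

open NormedSpace

variable {X : Type*} [NormedAddCommGroup X] [InnerProductSpace ℂ X]

/-- A bounded operator is dissipative if `Re ⟪A x, x⟫ ≤ 0` for all `x`. -/
def ContinuousLinearMap.IsDissipative (A : X →L[ℂ] X) : Prop :=
  ∀ x, (⟪A x, x⟫_ℂ).re ≤ 0

/-- A partially defined operator is dissipative if `Re ⟪B x, x⟫ ≤ 0` for all `x ∈ D(B)`. -/
def LinearPMap.IsDissipative (B : X →ₗ.[ℂ] X) : Prop :=
  ∀ x : B.domain, (⟪B x, (x : X)⟫_ℂ).re ≤ 0

/-! ### Exponentials of bounded dissipative operators -/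

section BoundedGenerators

variable [CompleteSpace X]

lemma hasDerivAt_exp_smul_apply (A : X →L[ℂ] X) (x : X) (t : ℝ) :
    HasDerivAt (fun s : ℝ => exp (s • A) x) (exp (t • A) (A x)) t := by
  have h := hasDerivAt_exp_smul_const (𝕂 := ℝ) A t
  exact (((ContinuousLinearMap.apply ℂ X x).restrictScalars ℝ).hasFDerivAt.comp_hasDerivAt t h)

lemma exp_smul_apply_comm (A : X →L[ℂ] X) (x : X) (t : ℝ) :
    exp (t • A) (A x) = A (exp (t • A) x) :=
  congrArg (fun C : X →L[ℂ] X => C x)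
    (((Commute.refl A).smul_right t).exp_right).eq.symm

/-- The square of the norm along the orbit has derivative 2 Re⟨Au, u⟩ ≤ 0 at u = exp(sA)x, so it
decreases. -/
lemma ContinuousLinearMap.IsDissipative.norm_exp_smul_apply_le {A : X →L[ℂ] X}
    (hA : A.IsDissipative) {t : ℝ} (ht : 0 ≤ t) (x : X) : ‖exp (t • A) x‖ ≤ ‖x‖ := by
  let _ : InnerProductSpace ℝ X := InnerProductSpace.rclikeToReal ℂ X
  have hd : ∀ s, HasDerivAt (fun s : ℝ => ‖exp (s • A) x‖ ^ 2)
      (2 * ⟪exp (s • A) x, exp (s • A) (A x)⟫_ℝ) s :=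
    fun s => (hasDerivAt_exp_smul_apply A x s).norm_sq
  have hanti : Antitone (fun s : ℝ => ‖exp (s • A) x‖ ^ 2) := by
    refine antitone_of_deriv_nonpos (fun s => (hd s).differentiableAt) fun s => ?_
    rw [(hd s).deriv, exp_smul_apply_comm, real_inner_comm, real_inner_eq_re_inner ℂ]
    have := hA (exp (s • A) x)
    simp only [RCLike.re_to_complex]
    linarith
  have h := hanti ht
  simp only [zero_smul, exp_zero, one_apply_eq_self] at h
  exact (sq_le_sq₀ (norm_nonneg _) (norm_nonneg _)).1 h

/-- Mean value inequality for s ↦ exp(sA)x - sy. The vector y is free so that it can be the value at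
x of an unbounded operator approximated by A. -/
lemma norm_exp_smul_apply_sub_sub_le {A : X →L[ℂ] X} {t C : ℝ} (ht : 0 ≤ t) {x y : X}
    (h : ∀ s ∈ Icc 0 t, ‖exp (s • A) (A x) - y‖ ≤ C) :
    ‖exp (t • A) x - x - t • y‖ ≤ C * t := by
  have hd : ∀ s ∈ Icc 0 t, HasDerivWithinAt (fun s : ℝ => exp (s • A) x - s • y)
      (exp (s • A) (A x) - y) (Icc 0 t) s := fun s _ => by
    have h1 := (hasDerivAt_exp_smul_apply A x s).sub ((hasDerivAt_id s).smul_const y)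
    rw [one_smul] at h1
    exact h1.hasDerivWithinAt
  have := norm_image_sub_le_of_norm_deriv_le_segment' hd
    (fun s hs => h s (Ico_subset_Icc_self hs)) t ⟨ht, le_rfl⟩
  simp only [zero_smul, exp_zero, one_apply_eq_self, sub_zero] at this
  rwa [sub_right_comm]

lemma ContinuousLinearMap.IsDissipative.norm_exp_smul_apply_sub_le {A : X →L[ℂ] X}
    (hA : A.IsDissipative) {t : ℝ} (ht : 0 ≤ t) (x : X) :
    ‖exp (t • A) x - x‖ ≤ ‖A x‖ * t := by
  have := norm_exp_smul_apply_sub_sub_le (A := A) ht (x := x) (y := 0) (C := ‖A x‖) fun s hs => by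
    rw [sub_zero]; exact hA.norm_exp_smul_apply_le hs.1 _
  simpa using this

/-- The path s ↦ exp(sA) exp((t-s)B)x joins the two vectors; by commutation its derivative is
exp(sA) exp((t-s)B)(Ax - Bx), and both exponentials are contractions. -/
lemma ContinuousLinearMap.IsDissipative.norm_exp_sub_exp_le {A B : X →L[ℂ] X}
    (hA : A.IsDissipative) (hB : B.IsDissipative) (hAB : Commute A B) {t : ℝ} (ht : 0 ≤ t)
    (x : X) : ‖exp (t • A) x - exp (t • B) x‖ ≤ ‖A x - B x‖ * t := by
  have hd : ∀ s ∈ Icc 0 t, HasDerivWithinAt (fun s : ℝ => exp (s • A) (exp ((t - s) • B) x))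
      (exp (s • A) (exp ((t - s) • B) (A x - B x))) (Icc 0 t) s := fun s _ => by
    have h1 := hasDerivAt_exp_smul_const (𝕂 := ℝ) A s
    have h2 : HasDerivAt (fun s : ℝ => exp ((t - s) • B) x)
        (-exp ((t - s) • B) (B x)) s := by
      have := (hasDerivAt_exp_smul_apply B x (t - s)).scomp s ((hasDerivAt_id s).const_sub t)
      simpa [Function.comp_def] using this
    have h1' : HasDerivAt (fun s : ℝ => (exp (s • A)).restrictScalars ℝ)
        ((exp (s • A) * A).restrictScalars ℝ) s :=
      (ContinuousLinearMap.restrictScalarsL ℂ X X ℝ ℝ).hasFDerivAt.comp_hasDerivAt s h1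
    have h3 := h1'.clm_apply h2
    have hc : A (exp ((t - s) • B) x) = exp ((t - s) • B) (A x) :=
      congrArg (fun C : X →L[ℂ] X => C x) ((hAB.smul_right (t - s)).exp_right).eq
    refine h3.hasDerivWithinAt.congr_deriv ?_
    simp only [ContinuousLinearMap.coe_restrictScalars', map_neg,
      map_sub]
    rw [← hc]
    simp [sub_eq_add_neg]
  have := norm_image_sub_le_of_norm_deriv_le_segment' hd (C := ‖A x - B x‖)
    (fun s hs => (hA.norm_exp_smul_apply_le hs.1 _).trans
      (hB.norm_exp_smul_apply_le (sub_nonneg.2 hs.2.le) _)) t ⟨ht, le_rfl⟩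
  simpa using this

end BoundedGenerators

end SemigroupTheory

/-! ### The Lumer–Phillips theorem -/

section LumerPhillips

open NormedSpace

variable {X : Type*} [NormedAddCommGroup X] [InnerProductSpace ℂ X]

lemma eq_zero_of_re_inner_self_nonpos {x : X} (h : (⟪x, x⟫_ℂ).re ≤ 0) : x = 0 := by
  rw [inner_self_eq_norm_sq_to_K] at h
  norm_cast at h
  exact norm_eq_zero.1 (pow_eq_zero_iff two_ne_zero |>.1 (le_antisymm h (by positivity)))

/-- Dissipativity gives c‖x‖² ≤ Re⟨cx - Bx, x⟩; apply Cauchy–Schwarz and divide by ‖x‖. -/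
lemma LinearPMap.IsDissipative.mul_norm_le {B : X →ₗ.[ℂ] X} (hB : B.IsDissipative) (c : ℝ)
    (x : B.domain) : c * ‖(x : X)‖ ≤ ‖(c : ℂ) • (x : X) - B x‖ := by
  rcases eq_or_ne (x : X) 0 with hx | hx
  · rw [hx, norm_zero, mul_zero]; exact norm_nonneg _
  have h1 : c * ‖(x : X)‖ ^ 2 ≤ (⟪(c : ℂ) • (x : X) - B x, (x : X)⟫_ℂ).re := by
    have h2 : (⟪(x : X), (x : X)⟫_ℂ) = ((‖(x : X)‖ ^ 2 : ℝ) : ℂ) := by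
      rw [inner_self_eq_norm_sq_to_K]; norm_cast
    rw [inner_sub_left, inner_smul_left, Complex.conj_ofReal, h2, ← Complex.ofReal_mul,
      Complex.sub_re, Complex.ofReal_re]
    linarith [hB x]
  have h3 := h1.trans ((Complex.re_le_norm _).trans (norm_inner_le_norm _ _))
  have h4 : 0 < ‖(x : X)‖ := norm_pos_iff.2 hx
  refine le_of_mul_le_mul_right ?_ h4
  linarith [h3, sq ‖(x : X)‖]

/-- The resolvent of a dissipative operator. -/
lemma LinearPMap.IsDissipative.exists_resolvent {B : X →ₗ.[ℂ] X} (hB : B.IsDissipative) {c : ℝ}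
    (hc : 0 < c) (hsurj : ∀ f, ∃ x : B.domain, (c : ℂ) • (x : X) - B x = f) :
    ∃ R : X →L[ℂ] X, (∀ f, ∃ x : B.domain, (x : X) = R f ∧ (c : ℂ) • (x : X) - B x = f) ∧
      (∀ x : B.domain, R ((c : ℂ) • (x : X) - B x) = x) ∧ ∀ f, c * ‖R f‖ ≤ ‖f‖ := by
  let L : B.domain →ₗ[ℂ] X := (c : ℂ) • B.domain.subtype - B.toFun
  have hL : ∀ x, L x = (c : ℂ) • (x : X) - B x := fun x => rfl
  have hinj : Function.Injective L := by
    refine (injective_iff_map_eq_zero L).2 fun x hx => ?_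
    have h := hB.mul_norm_le c x
    rw [← hL, hx, norm_zero] at h
    exact Subtype.ext (norm_le_zero_iff.1 (nonpos_of_mul_nonpos_right h hc))
  let e := LinearEquiv.ofBijective L ⟨hinj, hsurj⟩
  have he : ∀ f, (c : ℂ) • (e.symm f : X) - B (e.symm f) = f := fun f =>
    (hL _).symm.trans (e.apply_symm_apply f)
  have hbound : ∀ f, c * ‖(e.symm f : X)‖ ≤ ‖f‖ := fun f => by
    conv_rhs => rw [← he f]
    exact hB.mul_norm_le c _
  refine ⟨(B.domain.subtype ∘ₗ e.symm.toLinearMap).mkContinuous c⁻¹ fun f => ?_,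
    fun f => ⟨e.symm f, rfl, he f⟩, fun x => ?_, fun f => hbound f⟩
  · rw [inv_mul_eq_div, le_div_iff₀' hc]; exact hbound f
  · exact congrArg Subtype.val (e.symm_apply_apply x)

/-- In a Hilbert space, a dissipative operator with `1 - B` onto is densely defined. -/
lemma LinearPMap.IsDissipative.dense_domain [CompleteSpace X] {B : X →ₗ.[ℂ] X}
    (hB : B.IsDissipative) (hsurj : ∀ f, ∃ x : B.domain, (x : X) - B x = f) :
    Dense (B.domain : Set X) := by
  rw [Submodule.dense_iff_topologicalClosure_eq_top, Submodule.topologicalClosure_eq_top_iff,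
    Submodule.eq_bot_iff]
  intro v hv
  -- If v = x - Bx is orthogonal to the domain, pairing it with x itself gives ‖x‖² = Re⟨Bx, x⟩ ≤ 0.
  obtain ⟨x, hx⟩ := hsurj v
  have h := (Submodule.mem_orthogonal' _ _).1 hv x x.2
  have h4 : (x : X) = 0 := by
    refine eq_zero_of_re_inner_self_nonpos ?_
    rw [← hx, inner_sub_left, sub_eq_zero] at h
    rw [h]
    exact hB x
  have h5 : x = 0 := Subtype.ext h4
  rw [← hx, h5]; simp

/-- A densely defined operator that is approximated by commuting bounded dissipative operators
yields a contraction semigroup. -/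
lemma exists_contractionSemigroup_of_approx [CompleteSpace X] {B : X →ₗ.[ℂ] X}
    (hdense : Dense (B.domain : Set X)) (A : ℕ → X →L[ℂ] X) (hA : ∀ n, (A n).IsDissipative)
    (hcomm : ∀ m n, Commute (A m) (A n)) (hle : ∀ n (x : B.domain), ‖A n x‖ ≤ ‖B x‖)
    (hlim : ∀ x : B.domain, Tendsto (fun n => A n x) atTop (𝓝 (B x))) :
    ∃ T : ℝ≥0 → X →L[ℂ] X, PHS.IsContractionC0Semigroup T ∧
      ∀ x : B.domain, Tendsto (fun t : ℝ≥0 => ((t : ℝ) : ℂ)⁻¹ • (T t x - x)) (𝓝[>] 0)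
        (𝓝 (B x)) := by
  have happrox : ∀ (x : X) {ε : ℝ}, 0 < ε → ∃ y : B.domain, ‖x - y‖ < ε := fun x ε hε => by
    obtain ⟨y, hy, hxy⟩ := Metric.dense_iff.1 hdense x ε hε
    exact ⟨⟨_, hxy⟩, by rw [← dist_eq_norm, dist_comm]; exact hy⟩
  have hdiff : ∀ n (t : ℝ≥0) (x y : X), ‖exp ((t : ℝ) • A n) x - exp ((t : ℝ) • A n) y‖ ≤ ‖x - y‖ :=
    fun n t x y => by rw [← map_sub]; exact (hA n).norm_exp_smul_apply_le t.2 _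
  have hcauchy : ∀ (t : ℝ≥0) (x : X), CauchySeq fun n => exp ((t : ℝ) • A n) x := by
    intro t x
    refine Metric.cauchySeq_iff'.2 fun ε hε => ?_
    obtain ⟨y, hy⟩ := happrox x (show 0 < ε / 4 by positivity)
    -- Dividing by t + 1 rather than t keeps the tolerance meaningful at t = 0.
    obtain ⟨N, hN⟩ := Metric.cauchySeq_iff'.1 (hlim y).cauchySeq (ε / (4 * (t + 1)))
      (by positivity)
    refine ⟨N, fun n hn => ?_⟩
    have h1 := hdiff n t x y
    have h2 := hdiff N t y x
    rw [norm_sub_rev (y : X)] at h2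
    have h3 := (hA n).norm_exp_sub_exp_le (hA N) (hcomm n N) t.2 (y : X)
    have h4 := (hN n hn).le
    rw [dist_eq_norm] at h4 ⊢
    have h5 : ‖A n y - A N y‖ * (t : ℝ) ≤ ε / 4 := by
      calc _ ≤ ε / (4 * (t + 1)) * (t + 1) := by gcongr; linarith
        _ = ε / 4 := by field_simp
    calc ‖exp ((t : ℝ) • A n) x - exp ((t : ℝ) • A N) x‖
        = ‖(exp ((t : ℝ) • A n) x - exp ((t : ℝ) • A n) y) +
          (exp ((t : ℝ) • A n) y - exp ((t : ℝ) • A N) y) +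
          (exp ((t : ℝ) • A N) y - exp ((t : ℝ) • A N) x)‖ := by congr 1; abel
      _ ≤ _ := norm_add₃_le
      _ < ε := by linarith!
  choose S hS using fun t x => cauchySeq_tendsto_of_complete (hcauchy t x)
  let T : ℝ≥0 → X →L[ℂ] X := fun t =>
    continuousLinearMapOfTendsto (fun n => exp ((t : ℝ) • A n)) (tendsto_pi_nhds.2 (hS t))
  have hT : ∀ (t : ℝ≥0) (x : X), Tendsto (fun n => exp ((t : ℝ) • A n) x) atTop (𝓝 (T t x)) := hS
  have hTle : ∀ t x, ‖T t x‖ ≤ ‖x‖ := fun t x =>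
    le_of_tendsto (hT t x).norm (.of_forall fun n => (hA n).norm_exp_smul_apply_le t.2 x)
  have hTdom : ∀ (t : ℝ≥0) (x : B.domain), ‖T t x - x‖ ≤ ‖B x‖ * (t : ℝ) := fun t x =>
    le_of_tendsto ((hT t x).sub_const _).norm (.of_forall fun n =>
      ((hA n).norm_exp_smul_apply_sub_le t.2 x).trans
        (mul_le_mul_of_nonneg_right (hle n x) t.2))
  have hT0 : ∀ x, Tendsto (fun t => T t x) (𝓝 0) (𝓝 x) := by
    intro x
    refine Metric.tendsto_nhds.2 fun ε hε => ?_
    obtain ⟨y, hy⟩ := happrox x (show 0 < ε / 4 by positivity)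
    have hcont : Tendsto (fun t : ℝ≥0 => ‖B y‖ * (t : ℝ)) (𝓝 0) (𝓝 0) := by
      have : Continuous fun t : ℝ≥0 => ‖B y‖ * (t : ℝ) := by fun_prop
      simpa using this.tendsto 0
    filter_upwards [hcont.eventually (gt_mem_nhds (show 0 < ε / 4 by positivity))] with t ht
    have h1 := hTle t (x - y)
    have h2 := hTdom t y
    rw [dist_eq_norm]
    calc ‖T t x - x‖ = ‖T t (x - y) + (T t y - y) + (y - x)‖ := by
          rw [map_sub]; congr 1; abel
      _ ≤ _ := norm_add₃_le
      _ < ε := by rw [norm_sub_rev (y : X) x]; linarith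
  refine ⟨T, ⟨?_, ?_, hT0, fun t => (T t).opNorm_le_bound zero_le_one fun x => by
    rw [one_mul]; exact hTle t x⟩, ?_⟩
  · ext x
    refine tendsto_nhds_unique (hT 0 x) ?_
    simp
  · intro s t
    ext x
    refine tendsto_nhds_unique (hT (s + t) x) ?_
    have h1 : ∀ n, exp (((s + t : ℝ≥0) : ℝ) • A n) x
        = exp ((s : ℝ) • A n) (exp ((t : ℝ) • A n) x) := fun n => by
      let _ : NormedAlgebra ℚ (X →L[ℂ] X) := NormedAlgebra.restrictScalars ℚ ℂ _
      rw [NNReal.coe_add, add_smul, exp_add_of_commute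
        (((Commute.refl (A n)).smul_left (s : ℝ)).smul_right (t : ℝ))]
      rfl
    simp_rw [h1]
    -- The inner vector may be replaced by its limit, because the outer exponentials are
    -- contractions uniformly in n.
    have h2 : Tendsto (fun n => exp ((s : ℝ) • A n) (exp ((t : ℝ) • A n) x)
        - exp ((s : ℝ) • A n) (T t x)) atTop (𝓝 0) := by
      refine squeeze_zero_norm (fun n => hdiff n s _ _) ?_
      have := ((hT t x).sub_const (T t x)).norm
      simpa using this
    simpa using h2.add (hT s (T t x))
  · intro x
    refine Metric.tendsto_nhds.2 fun ε hε => ?_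
    -- `B x` need not lie in the domain, so continuity of the orbit at `B x` is read off from a
    -- nearby y in the domain. Four errors of size ε/8 then add up to ε/2.
    obtain ⟨y, hy⟩ := happrox (B x) (show 0 < ε / 8 by positivity)
    have hcont : Tendsto (fun t : ℝ≥0 => ‖B y‖ * (t : ℝ)) (𝓝 0) (𝓝 0) := by
      have : Continuous fun t : ℝ≥0 => ‖B y‖ * (t : ℝ) := by fun_prop
      simpa using this.tendsto 0
    filter_upwards [(hcont.eventually (gt_mem_nhds (show 0 < ε / 8 by positivity))).filter_mono
      nhdsWithin_le_nhds, self_mem_nhdsWithin] with t ht ht0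
    have ht0' : (0 : ℝ) < t := ht0
    have hmain : ‖T t x - x - (t : ℝ) • B x‖ ≤ (ε / 2) * t := by
      refine le_of_tendsto (((hT t x).sub_const _).sub_const _).norm ?_
      have hev := Metric.tendsto_nhds.1 (hlim x) (ε / 8) (by positivity)
      filter_upwards [hev] with n hn
      refine norm_exp_smul_apply_sub_sub_le t.2 fun s hs => ?_
      have e1 := (hA n).norm_exp_smul_apply_le hs.1 (A n x - B x)
      have e2 := (hA n).norm_exp_smul_apply_le hs.1 (B x - y)
      have e3 := (hA n).norm_exp_smul_apply_sub_le hs.1 (y : X)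
      have e4 : ‖A n y‖ * s ≤ ‖B y‖ * t :=
        mul_le_mul (hle n y) hs.2 hs.1 (norm_nonneg _)
      rw [dist_eq_norm] at hn
      calc ‖exp (s • A n) (A n x) - B x‖
          = ‖exp (s • A n) (A n x - B x) + (exp (s • A n) (B x - y) +
            (exp (s • A n) y - y) + (y - B x))‖ := by
            rw [map_sub, map_sub]; congr 1; abel
        _ ≤ _ := (norm_add_le _ _).trans (add_le_add_right norm_add₃_le _)
        _ ≤ ε / 2 := by rw [norm_sub_rev (y : X)]; linarith
    have h1 : ((t : ℝ) : ℂ)⁻¹ • (T t x - x) - B x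
        = ((t : ℝ) : ℂ)⁻¹ • (T t x - x - (t : ℝ) • B x) := by
      have h0 : ((t : ℝ) : ℂ) ≠ 0 := Complex.ofReal_ne_zero.2 ht0'.ne'
      rw [smul_sub _ (T t x - x), ← Complex.coe_smul (t : ℝ), inv_smul_smul₀ h0]
    rw [dist_eq_norm, h1, norm_smul, norm_inv, Complex.norm_real, Real.norm_of_nonneg ht0'.le,
      inv_mul_eq_div, div_lt_iff₀ ht0']
    exact hmain.trans_lt (by gcongr; linarith)

/-- The generator of a contraction semigroup is dissipative. -/
lemma PHS.IsContractionC0Semigroup.re_inner_nonpos {T : ℝ≥0 → X →L[ℂ] X}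
    (hT : PHS.IsContractionC0Semigroup T) {x z : X}
    (h : Tendsto (fun t : ℝ≥0 => ((t : ℝ) : ℂ)⁻¹ • (T t x - x)) (𝓝[>] 0) (𝓝 z)) :
    (⟪z, x⟫_ℂ).re ≤ 0 := by
  have h1 := (Complex.continuous_re.tendsto _).comp (h.inner (tendsto_const_nhds (x := x)) (𝕜 := ℂ))
  refine le_of_tendsto h1 (.of_forall fun t => ?_)
  have h2 : (⟪T t x, x⟫_ℂ).re ≤ ‖x‖ ^ 2 := by
    refine (Complex.re_le_norm _).trans ((norm_inner_le_norm _ _).trans ?_)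
    have := (T t).le_of_opNorm_le (hT.norm_le_one t) x
    rw [sq]; gcongr; simpa using this
  have h3 : (⟪x, x⟫_ℂ).re = ‖x‖ ^ 2 := by rw [inner_self_eq_norm_sq_to_K]; norm_cast
  simp only [Function.comp_apply]
  rw [inner_smul_left, ← Complex.ofReal_inv, Complex.conj_ofReal, Complex.re_ofReal_mul,
    inner_sub_left, Complex.sub_re, h3]
  exact mul_nonpos_of_nonneg_of_nonpos (by positivity) (by linarith)

/-- **Lumer–Phillips theorem** in Hilbert spaces. -/
theorem LinearPMap.IsDissipative.generatesContractionSemigroup [CompleteSpace X] {B : X →ₗ.[ℂ] X}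
    (hB : B.IsDissipative)
    (hsurj : ∀ c : ℝ, 0 < c → ∀ f, ∃ x : B.domain, (c : ℂ) • (x : X) - B x = f) :
    PHS.GeneratesContractionSemigroup B := by
  have hsurj1 : ∀ f, ∃ x : B.domain, (x : X) - B x = f := fun f => by
    obtain ⟨x, hx⟩ := hsurj 1 one_pos f
    exact ⟨x, by simpa using hx⟩
  have hdense := hB.dense_domain hsurj1
  let c : ℕ → ℝ := fun n => n + 1
  have hc : ∀ n, 0 < c n := fun n => by positivity
  choose R hRdom hRinv hRle using fun n => hB.exists_resolvent (hc n) (hsurj (c n) (hc n))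
  -- Yosida approximation, with R the resolvent at c: c(cR - 1) is bounded, and equals cRB on the
  -- domain. It is dissipative because cR is a contraction.
  let A : ℕ → X →L[ℂ] X := fun n => (c n : ℂ) • ((c n : ℂ) • R n - 1)
  have hA_apply : ∀ n x, A n x = (c n : ℂ) • ((c n : ℂ) • R n x - x) := fun n x => rfl
  have hRle' : ∀ n f, ‖(c n : ℂ) • R n f‖ ≤ ‖f‖ := fun n f => by
    rw [norm_smul, Complex.norm_real, Real.norm_of_nonneg (hc n).le]; exact hRle n f
  have hAdiss : ∀ n, (A n).IsDissipative := fun n x => by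
    rw [hA_apply, inner_smul_left, Complex.conj_ofReal, Complex.re_ofReal_mul, inner_sub_left,
      Complex.sub_re]
    refine mul_nonpos_of_nonneg_of_nonpos (hc n).le (sub_nonpos.2 ?_)
    have h3 : (⟪x, x⟫_ℂ).re = ‖x‖ * ‖x‖ := by
      rw [inner_self_eq_norm_sq_to_K, ← sq]; norm_cast
    rw [h3]
    refine (Complex.re_le_norm _).trans ((norm_inner_le_norm _ _).trans ?_)
    gcongr
    exact hRle' n x
  have hAB : ∀ n (x : B.domain), A n x = (c n : ℂ) • R n (B x) := fun n x => by
    have h := hRinv n x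
    rw [_root_.map_sub, _root_.map_smul] at h
    rw [hA_apply, sub_eq_iff_eq_add.1 h, add_sub_cancel_left]
  have hRlim : ∀ x, Tendsto (fun n => (c n : ℂ) • R n x) atTop (𝓝 x) := by
    intro x
    refine Metric.tendsto_atTop.2 fun ε hε => ?_
    obtain ⟨y, hy, hxy⟩ := Metric.dense_iff.1 hdense x (ε / 3) (by positivity)
    obtain ⟨N, hN⟩ := exists_nat_gt (‖B ⟨y, hxy⟩‖ / (ε / 3))
    refine ⟨N, fun n hn => ?_⟩
    have h0 : (c n : ℂ) ≠ 0 := Complex.ofReal_ne_zero.2 (hc n).ne'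
    have h1 : ‖(c n : ℂ) • R n y - y‖ ≤ ε / 3 := by
      have h2 : (c n : ℂ) • R n y - y = R n (B ⟨y, hxy⟩) :=
        smul_right_injective X h0 (hAB n ⟨y, hxy⟩)
      rw [h2]
      have h3 := hRle n (B ⟨y, hxy⟩)
      have h4 : ‖B ⟨y, hxy⟩‖ ≤ c n * (ε / 3) := by
        rw [div_lt_iff₀ (by positivity)] at hN
        refine hN.le.trans ?_
        gcongr
        have : (N : ℝ) ≤ n := by exact_mod_cast hn
        simp only [c]; linarith
      exact le_of_mul_le_mul_left (h3.trans h4) (hc n)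
    have h5 := hRle' n (x - y)
    rw [Metric.mem_ball, dist_comm, dist_eq_norm] at hy
    rw [dist_eq_norm]
    calc ‖(c n : ℂ) • R n x - x‖
        = ‖(c n : ℂ) • R n (x - y) + ((c n : ℂ) • R n y - y) + (y - x)‖ := by
          rw [_root_.map_sub, smul_sub]; congr 1; abel
      _ ≤ _ := norm_add₃_le
      _ < ε := by rw [norm_sub_rev y x]; linarith
  -- Resolvent identity. Comparing it with its version under m ↔ n shows that the resolvents
  -- commute.
  have hRes : ∀ m n f, R n f - R m f = ((c m - c n : ℝ) : ℂ) • R n (R m f) := by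
    intro m n f
    obtain ⟨x, hx, hxf⟩ := hRdom m f
    have h1 := hRinv n x
    have h2 : (c n : ℂ) • (x : X) - B x = f - ((c m - c n : ℝ) : ℂ) • (x : X) := by
      rw [← hxf, Complex.ofReal_sub, sub_smul]; abel
    rw [h2, _root_.map_sub, _root_.map_smul] at h1
    rw [← hx, sub_eq_iff_eq_add.1 h1, add_sub_cancel_left]
  have hRcomm : ∀ m n, Commute (R m) (R n) := by
    intro m n
    rcases eq_or_ne (c m) (c n) with hmn | hmn
    · rw [show m = n by simpa [c] using hmn]
    · refine ContinuousLinearMap.ext fun f => ?_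
      have h1 := hRes m n f
      have h2 := hRes n m f
      have h3 : ((c m - c n : ℝ) : ℂ) ≠ 0 := Complex.ofReal_ne_zero.2 (sub_ne_zero.2 hmn)
      refine smul_right_injective X h3 ?_
      change ((c m - c n : ℝ) : ℂ) • R m (R n f) = ((c m - c n : ℝ) : ℂ) • R n (R m f)
      rw [← h1, ← neg_sub (R m f), h2, ← neg_smul, ← Complex.ofReal_neg, neg_sub]
  have hAcomm : ∀ m n, Commute (A m) (A n) := fun m n =>
    (((((hRcomm m n).smul_left _).smul_right _).sub_left (Commute.one_left _)).sub_right
      (Commute.one_right _)).smul_left _ |>.smul_right _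
  obtain ⟨T, hT, hTB⟩ := exists_contractionSemigroup_of_approx hdense A hAdiss hAcomm
    (fun n x => by rw [hAB]; exact hRle' n _) (fun x => by simp_rw [hAB]; exact hRlim _)
  refine ⟨T, hT, fun x z => ⟨?_, fun h => ?_⟩⟩
  · rw [LinearPMap.mem_graph_iff]
    rintro ⟨y, rfl, rfl⟩
    exact hTB y
  -- B is maximal: choosing y in its domain with y - By = x - z gives z - By = x - y, and
  -- dissipativity of the generator of T forces x = y.
  · obtain ⟨y, hy⟩ := hsurj1 (x - z)
    have h1 := h.sub (hTB y)
    have h2 : z - B y = x - y := by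
      rw [sub_eq_sub_iff_add_eq_add] at hy ⊢
      rw [add_comm z, hy]
    have h3 : (⟪z - B y, x - y⟫_ℂ).re ≤ 0 := by
      refine hT.re_inner_nonpos (h1.congr fun t => ?_)
      rw [← smul_sub, _root_.map_sub]; congr 1; abel
    have h4 : x - y = 0 := eq_zero_of_re_inner_self_nonpos (h2 ▸ h3)
    rw [LinearPMap.mem_graph_iff]
    exact ⟨y, (sub_eq_zero.1 h4).symm, (sub_eq_zero.1 (h2.trans h4)).symm⟩

end LumerPhillips

/-! ### Dissipativity of generators and surjectivity of 1 - B -/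

section Generators

variable {X : Type*} [NormedAddCommGroup X] [InnerProductSpace ℂ X]

lemma PHS.IsContractionC0Semigroup.norm_apply_sub_apply_le {T : ℝ≥0 → X →L[ℂ] X}
    (hT : PHS.IsContractionC0Semigroup T) (x : X) {s t : ℝ≥0} (h : s ≤ t) :
    ‖T t x - T s x‖ ≤ ‖T (t - s) x - x‖ := by
  have h1 : T t x = T s (T (t - s) x) := by
    conv_lhs => rw [← add_tsub_cancel_of_le h, hT.map_add]
    rfl
  rw [h1, ← map_sub]
  simpa using (T s).le_of_opNorm_le (hT.norm_le_one s) (T (t - s) x - x)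

lemma PHS.IsContractionC0Semigroup.continuous_apply {T : ℝ≥0 → X →L[ℂ] X}
    (hT : PHS.IsContractionC0Semigroup T) (x : X) : Continuous fun t => T t x := by
  refine Metric.continuous_iff.2 fun t ε hε => ?_
  obtain ⟨δ, hδ, h⟩ := Metric.tendsto_nhds_nhds.1 (hT.tendsto_zero x) ε hε
  refine ⟨δ, hδ, fun s hs => ?_⟩
  rw [NNReal.dist_eq] at hs
  rcases le_total s t with hst | hst
  · rw [dist_comm, dist_eq_norm]
    refine (hT.norm_apply_sub_apply_le x hst).trans_lt ?_
    rw [← dist_eq_norm]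
    refine h ?_
    rwa [NNReal.dist_eq, NNReal.coe_zero, sub_zero, NNReal.coe_sub hst, abs_sub_comm]
  · rw [dist_eq_norm]
    refine (hT.norm_apply_sub_apply_le x hst).trans_lt ?_
    rw [← dist_eq_norm]
    refine h ?_
    rwa [NNReal.dist_eq, NNReal.coe_zero, sub_zero, NNReal.coe_sub hst]

/-- The vector `v = ∫₀¹ e⁻ᵗ T(t) x dt` lies in the domain of the generator `B`, and
`v - B v = x - e⁻¹ T(1) x`. -/
lemma PHS.IsContractionC0Semigroup.tendsto_slope_integral [CompleteSpace X]
    {T : ℝ≥0 → X →L[ℂ] X} (hT : PHS.IsContractionC0Semigroup T) (x : X) :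
    Tendsto (fun h : ℝ≥0 => ((h : ℝ) : ℂ)⁻¹ •
      (T h (∫ t in (0 : ℝ)..1, Real.exp (-t) • T t.toNNReal x) -
        ∫ t in (0 : ℝ)..1, Real.exp (-t) • T t.toNNReal x)) (𝓝[>] 0)
      (𝓝 ((∫ t in (0 : ℝ)..1, Real.exp (-t) • T t.toNNReal x) - x + Real.exp (-1) • T 1 x)) := by
  set g : ℝ → X := fun t => Real.exp (-t) • T t.toNNReal x with hg
  have hgc : Continuous g := by
    exact (Real.continuous_exp.comp continuous_neg).smul
      ((hT.continuous_apply x).comp continuous_real_toNNReal)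
  set F : ℝ → X := fun s => ∫ t in (0 : ℝ)..s, g t with hF
  have hFd : ∀ s, HasDerivAt F (g s) s := fun s =>
    intervalIntegral.integral_hasDerivAt_right (hgc.intervalIntegrable _ _)
      (hgc.stronglyMeasurableAtFilter _ _) hgc.continuousAt
  have hF0 : F 0 = 0 := intervalIntegral.integral_same
  -- The semigroup law and the substitution t ↦ t + h turn T(h)F(1) into eʰ times the integral of g
  -- over [h, 1 + h]. The limit is thereby the derivative at 0 of an explicit function.
  have hshift : ∀ h : ℝ≥0, T h (F 1) = Real.exp h • (F (1 + h) - F h) := by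
    intro h
    have h1 : T h (F 1) = ∫ t in (0 : ℝ)..1, Real.exp h • g (t + h) := by
      simp only [hF]
      rw [← ContinuousLinearMap.intervalIntegral_comp_comm _ (hgc.intervalIntegrable _ _)]
      refine intervalIntegral.integral_congr fun t ht => ?_
      rw [uIcc_of_le zero_le_one] at ht
      have h2 : (t + h).toNNReal = h + t.toNNReal := by
        rw [Real.toNNReal_add ht.1 h.coe_nonneg, Real.toNNReal_coe, add_comm]
      simp only [hg]
      rw [h2, hT.map_add, smul_smul, ← Real.exp_add, show (h : ℝ) + -(t + h) = -t by ring,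
        ContinuousLinearMap.map_smul_of_tower]
      rfl
    rw [h1, intervalIntegral.integral_smul, intervalIntegral.integral_comp_add_right, zero_add]
    congr 1
    have := intervalIntegral.integral_interval_sub_left (μ := volume)
      (hgc.intervalIntegrable 0 (1 + h)) (hgc.intervalIntegrable 0 (h : ℝ))
    exact this.symm
  have hd : HasDerivAt (fun h : ℝ => Real.exp h • (F (1 + h) - F h))
      (F 1 - x + Real.exp (-1) • T 1 x) 0 := by
    have h1 : HasDerivAt (fun h : ℝ => F (1 + h)) (g 1) 0 := by
      have h3 : HasDerivAt F (g 1) (1 + 0) := by rw [add_zero]; exact hFd 1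
      have := h3.scomp (0 : ℝ) ((hasDerivAt_id (0 : ℝ)).const_add 1)
      simpa [Function.comp_def] using this
    have h2 := (Real.hasDerivAt_exp 0).smul (h1.sub (hFd 0))
    refine h2.congr_deriv ?_
    simp [hg, hF0, hT.map_zero]
    abel
  have hs := hd.tendsto_slope_zero_right
  have hc : Tendsto (fun h : ℝ≥0 => (h : ℝ)) (𝓝[>] 0) (𝓝[>] 0) := by
    refine tendsto_nhdsWithin_iff.2 ⟨?_, ?_⟩
    · exact (NNReal.continuous_coe.tendsto' 0 0 rfl).mono_left nhdsWithin_le_nhds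
    · filter_upwards [self_mem_nhdsWithin] with t ht using NNReal.coe_pos.2 ht
  refine (hs.comp hc).congr fun h => ?_
  simp only [Function.comp_apply, zero_add, Real.exp_zero, one_smul, add_zero, hF0, sub_zero]
  rw [← hshift, ← Complex.coe_smul, Complex.ofReal_inv]

theorem PHS.IsGenerator.isDissipative {B : X →ₗ.[ℂ] X} {T : ℝ≥0 → X →L[ℂ] X}
    (hT : PHS.IsContractionC0Semigroup T) (hB : PHS.IsGenerator B T) : B.IsDissipative := fun x =>
  hT.re_inner_nonpos ((hB x (B x)).1 (B.mem_graph x))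

/-- A Laplace transform cut off at time 1 suffices: the integral solves v - Bv = w - e⁻¹T(1)w, and 1
- e⁻¹T(1) is invertible by the Neumann series, so w can be chosen to make the right side f. -/
theorem PHS.IsGenerator.surjective_sub [CompleteSpace X] {B : X →ₗ.[ℂ] X} {T : ℝ≥0 → X →L[ℂ] X}
    (hT : PHS.IsContractionC0Semigroup T) (hB : PHS.IsGenerator B T) (f : X) :
    ∃ x : B.domain, (x : X) - B x = f := by
  have hunit : IsUnit (1 - Real.exp (-1) • T 1) := by
    refine isUnit_one_sub_of_norm_lt_one ?_
    rw [norm_smul, Real.norm_of_nonneg (Real.exp_pos _).le]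
    calc _ ≤ Real.exp (-1) * 1 := by gcongr; exact hT.norm_le_one 1
      _ < 1 := by rw [mul_one, Real.exp_lt_one_iff]; norm_num
  obtain ⟨u, hu⟩ := hunit
  set w := (↑u⁻¹ : X →L[ℂ] X) f with hw
  have hwf : w - Real.exp (-1) • T 1 w = f := by
    have h1 : (1 - Real.exp (-1) • T 1) w = f := by
      rw [← hu, hw]
      exact congrArg (fun C : X →L[ℂ] X => C f) u.mul_inv
    exact h1
  have h2 := (hB _ _).2 (hT.tendsto_slope_integral w)
  rw [LinearPMap.mem_graph_iff] at h2
  obtain ⟨y, hy, hBy⟩ := h2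
  dsimp only at hy hBy
  refine ⟨y, ?_⟩
  rw [hBy, hy, ← hwf]
  abel

end Generators

/-! ### Absolutely continuous vector-valued functions -/

section AbsolutelyContinuous

/-- The bound is summed over the subintervals. Two dominating functions serve the product in
`ac_inner`; the other uses pass the same function twice. -/
lemma AbsolutelyContinuousOnInterval.of_dist_le_add {X Y Z : Type*} [PseudoMetricSpace X]
    [PseudoMetricSpace Y] [PseudoMetricSpace Z] {f : ℝ → X} {g : ℝ → Y} {h : ℝ → Z} {a b C : ℝ}
    (hg : AbsolutelyContinuousOnInterval g a b) (hh : AbsolutelyContinuousOnInterval h a b)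
    (hf : ∀ s ∈ uIcc a b, ∀ t ∈ uIcc a b,
      dist (f s) (f t) ≤ C * dist (g s) (g t) + C * dist (h s) (h t)) :
    AbsolutelyContinuousOnInterval f a b := by
  have hlim := (Tendsto.const_mul C hg).add (Tendsto.const_mul C hh)
  rw [mul_zero, add_zero] at hlim
  refine squeeze_zero' (.of_forall fun E => Finset.sum_nonneg fun _ _ => dist_nonneg) ?_ hlim
  refine eventually_inf_principal.2 (.of_forall fun E hE => ?_)
  rw [Finset.mul_sum, Finset.mul_sum, ← Finset.sum_add_distrib]
  exact Finset.sum_le_sum fun i hi => hf _ (hE.1 i hi).1 _ (hE.1 i hi).2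

variable {E : Type*} [NormedAddCommGroup E] [NormedSpace ℝ E]

lemma IntervalIntegrable.absolutelyContinuousOnInterval_primitive {f : ℝ → E} {a b : ℝ}
    (hf : IntervalIntegrable f volume a b) :
    AbsolutelyContinuousOnInterval (fun x => ∫ v in a..x, f v) a b := by
  have h1 := hf.norm.absolutelyContinuousOnInterval_intervalIntegral (left_mem_uIcc (a := a))
  refine h1.of_dist_le_add (C := 1) h1 fun s hs t ht => ?_
  have hi : ∀ u ∈ uIcc a b, IntervalIntegrable f volume a u := fun u hu =>
    hf.mono_set (uIcc_subset_uIcc_left hu)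
  rw [one_mul, dist_comm (∫ v in a..s, f v), dist_eq_norm, dist_comm (∫ v in a..s, ‖f v‖),
    Real.dist_eq, intervalIntegral.integral_interval_sub_left (hi t ht) (hi s hs),
    intervalIntegral.integral_interval_sub_left (hi t ht).norm (hi s hs).norm]
  exact intervalIntegral.norm_integral_le_abs_integral_norm.trans
    (le_add_of_nonneg_right (abs_nonneg _))

/-- Subtracting the primitive of f' leaves an absolutely continuous function with derivative zero
almost everywhere, hence a constant. -/
lemma AbsolutelyContinuousOnInterval.integral_deriv_eq_sub' [FiniteDimensional ℝ E] {f : ℝ → E}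
    {a b : ℝ} (hf : AbsolutelyContinuousOnInterval f a b)
    (hi : IntervalIntegrable (deriv f) volume a b) :
    ∫ x in a..b, deriv f x = f b - f a := by
  have : CompleteSpace E := FiniteDimensional.complete ℝ E
  have hg : AbsolutelyContinuousOnInterval (fun x => f x - ∫ t in a..x, deriv f t) a b :=
    hf.sub hi.absolutelyContinuousOnInterval_primitive
  have hg0 : ∀ᵐ x, x ∈ uIcc a b → HasDerivAt (fun x => f x - ∫ t in a..x, deriv f t) 0 x := by
    filter_upwards [hf.boundedVariationOn.ae_differentiableAt_of_mem_uIcc,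
      hi.ae_hasDerivAt_integral] with x h1 h2 h3
    have h4 := (h1 h3).hasDerivAt.sub (h2 h3 a left_mem_uIcc)
    rw [sub_self] at h4
    exact h4
  obtain ⟨C, hC⟩ := hg.const_of_ae_hasDerivAt_zero hg0
  have h1 := hC a left_mem_uIcc
  have h2 := hC b right_mem_uIcc
  simp only [intervalIntegral.integral_same, sub_zero] at h1
  rw [← h1] at h2
  rw [← h2, sub_sub_cancel]

end AbsolutelyContinuous

/-! ### Integration by parts, weak derivatives and Green's identity -/

namespace PHS

variable {d : ℕ} {a b : ℝ}

lemma ac_inner {y w : ℝ → Vec d} (hy : AbsolutelyContinuousOnInterval y a b)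
    (hw : AbsolutelyContinuousOnInterval w a b) :
    AbsolutelyContinuousOnInterval (fun ξ => ⟪y ξ, w ξ⟫_ℂ) a b := by
  obtain ⟨C₁, h₁⟩ := hy.exists_bound
  obtain ⟨C₂, h₂⟩ := hw.exists_bound
  refine hy.of_dist_le_add (C := max C₁ C₂) hw fun s hs t ht => ?_
  have h : ⟪y s, w s⟫_ℂ - ⟪y t, w t⟫_ℂ = ⟪y s - y t, w s⟫_ℂ + ⟪y t, w s - w t⟫_ℂ := by
    rw [inner_sub_left, inner_sub_right]; ring
  rw [dist_eq_norm, dist_eq_norm, dist_eq_norm, h]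
  refine (norm_add_le _ _).trans (add_le_add ?_ ?_)
  · refine (norm_inner_le_norm _ _).trans ?_
    rw [mul_comm]
    gcongr
    exact (h₂ s hs).trans (le_max_right _ _)
  · refine (norm_inner_le_norm _ _).trans ?_
    gcongr
    exact (h₁ t ht).trans (le_max_left _ _)

lemma intervalIntegral_eq_vol {E : Type*} [NormedAddCommGroup E] [NormedSpace ℝ E] (hab : a < b)
    (f : ℝ → E) : ∫ ξ in a..b, f ξ = ∫ ξ, f ξ ∂vol a b := by
  rw [intervalIntegral.integral_of_le hab.le, integral_Ioc_eq_integral_Ioo]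

lemma intervalIntegrable_iff_vol {E : Type*} [NormedAddCommGroup E] (hab : a < b)
    (f : ℝ → E) : IntervalIntegrable f volume a b ↔ Integrable f (vol a b) := by
  rw [intervalIntegrable_iff_integrableOn_Ioo_of_le hab.le]; rfl

lemma H1.coeFn_toL2 (y : H1 d a b) : H1.toL2 d a b y =ᵐ[vol a b] y.1 :=
  MemLp.coeFn_toLp (ac_memLp y.2.1)

lemma H1.coeFn_derivL2 (y : H1 d a b) : H1.derivL2 d a b y =ᵐ[vol a b] deriv y.1 :=
  MemLp.coeFn_toLp y.2.2

/-- Integration by parts in `H¹`. -/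
lemma H1.inner_derivL2_add (hab : a < b) (y w : H1 d a b) :
    ⟪H1.derivL2 d a b y, H1.toL2 d a b w⟫_ℂ + ⟪H1.toL2 d a b y, H1.derivL2 d a b w⟫_ℂ =
      ⟪y.1 b, w.1 b⟫_ℂ - ⟪y.1 a, w.1 a⟫_ℂ := by
  have hi := (L2.integrable_inner (𝕜 := ℂ) (H1.derivL2 d a b y) (H1.toL2 d a b w)).add
    (L2.integrable_inner (𝕜 := ℂ) (H1.toL2 d a b y) (H1.derivL2 d a b w))
  have hae : (fun ξ => ⟪H1.derivL2 d a b y ξ, H1.toL2 d a b w ξ⟫_ℂ +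
      ⟪H1.toL2 d a b y ξ, H1.derivL2 d a b w ξ⟫_ℂ) =ᵐ[vol a b]
      deriv fun ξ => ⟪y.1 ξ, w.1 ξ⟫_ℂ := by
    filter_upwards [ac_ae_differentiableAt y.2.1, ac_ae_differentiableAt w.2.1, H1.coeFn_toL2 y,
      H1.coeFn_toL2 w, H1.coeFn_derivL2 y, H1.coeFn_derivL2 w] with ξ h1 h2 h3 h4 h5 h6
    rw [h3, h4, h5, h6, (h1.hasDerivAt.inner ℂ h2.hasDerivAt).deriv, add_comm]
  rw [L2.inner_def, L2.inner_def, ← integral_add (L2.integrable_inner _ _)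
    (L2.integrable_inner _ _), integral_congr_ae hae, ← intervalIntegral_eq_vol hab]
  refine (ac_inner y.2.1 w.2.1).integral_deriv_eq_sub' ?_
  rw [intervalIntegrable_iff_vol hab]
  exact hi.congr hae

lemma L2.integrable (f : L2 d a b) : Integrable f (vol a b) :=
  (Lp.memLp f).integrable one_le_two

/-- With c = 0 and g of mean zero this produces test functions vanishing at both endpoints. -/
lemma H1.exists_primitive (hab : a < b) (g : L2 d a b) (c : Vec d) :
    ∃ y : H1 d a b, H1.derivL2 d a b y = g ∧ y.1 a = c ∧ y.1 b = c + ∫ ξ, g ξ ∂vol a b := by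
  have hi := (intervalIntegrable_iff_vol hab _).2 (L2.integrable g)
  have hac : AbsolutelyContinuousOnInterval (fun x => c + ∫ v in a..x, g v) a b :=
    (LipschitzWith.const c).lipschitzOnWith.absolutelyContinuousOnInterval.add
      hi.absolutelyContinuousOnInterval_primitive
  have hd : deriv (fun x => c + ∫ v in a..x, g v) =ᵐ[vol a b] g := by
    refine (ae_restrict_iff' measurableSet_Ioo).2 ?_
    filter_upwards [hi.ae_hasDerivAt_integral] with x h1 h2
    exact ((h1 (Ioo_subset_Icc_self.trans Icc_subset_uIcc h2) a left_mem_uIcc).const_add c).deriv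
  have hm : MemLp (deriv fun x => c + ∫ v in a..x, g v) 2 (vol a b) :=
    (memLp_congr_ae hd).2 (Lp.memLp g)
  refine ⟨⟨_, hac, hm⟩, ?_, by simp, ?_⟩
  · exact Lp.ext ((MemLp.coeFn_toLp hm).trans hd)
  · simp only [intervalIntegral_eq_vol hab]

lemma integral_const_vol (hab : a < b) (c : Vec d) :
    ∫ _, c ∂vol a b = (b - a) • c := by
  rw [← intervalIntegral_eq_vol hab, intervalIntegral.integral_const]

/-- The constant functions in `H¹`. -/
def H1.const (a b : ℝ) (c : Vec d) : H1 d a b :=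
  ⟨fun _ => c, (LipschitzWith.const c).lipschitzOnWith.absolutelyContinuousOnInterval, by
    rw [show deriv (fun _ : ℝ => c) = 0 from funext fun x => deriv_const x c]; exact MemLp.zero⟩

lemma H1.derivL2_const (c : Vec d) : H1.derivL2 d a b (H1.const a b c) = 0 := by
  refine Lp.ext ((H1.coeFn_derivL2 _).trans (.trans ?_ (Lp.coeFn_zero _ _ _).symm))
  exact .of_forall fun x => deriv_const x c

/-- The boundary values of `H¹`-functions can be prescribed. -/
lemma H1.exists_boundary (hab : a < b) (p q : Vec d) :
    ∃ y : H1 d a b, y.1 a = p ∧ y.1 b = q := by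
  obtain ⟨y, -, ha, hb⟩ := H1.exists_primitive hab
    (H1.toL2 d a b (H1.const a b ((b - a)⁻¹ • (q - p)))) p
  refine ⟨y, ha, ?_⟩
  rw [hb, integral_congr_ae (H1.coeFn_toL2 _)]
  simp only [H1.const]
  rw [integral_const_vol hab, smul_inv_smul₀ (sub_pos.2 hab).ne', add_sub_cancel]

/-- The **du Bois-Reymond lemma**: a weakly differentiable `L²`-function lies in `H¹`. -/
lemma H1.exists_of_weak_deriv (hab : a < b) (h g : L2 d a b)
    (hw : ∀ w ∈ zeroBoundary d a b,
      ⟪h, H1.derivL2 d a b w⟫_ℂ + ⟪g, H1.toL2 d a b w⟫_ℂ = 0) :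
    ∃ y : H1 d a b, H1.toL2 d a b y = h ∧ H1.derivL2 d a b y = g := by
  obtain ⟨G, hG, -, -⟩ := H1.exists_primitive hab g 0
  -- The difference k has weak derivative zero; u is k minus its mean c. The primitive w of u
  -- vanishes at a and b, and testing with w makes u orthogonal to both k and c, hence to itself.
  set k : L2 d a b := h - H1.toL2 d a b G with hk
  set c : Vec d := (b - a)⁻¹ • ∫ ξ, k ξ ∂vol a b with hc
  set u : L2 d a b := k - H1.toL2 d a b (H1.const a b c) with hu
  have hu0 : ∫ ξ, u ξ ∂vol a b = 0 := by
    have h1 : u =ᵐ[vol a b] fun ξ => k ξ - c := by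
      filter_upwards [Lp.coeFn_sub k (H1.toL2 d a b (H1.const a b c)),
        H1.coeFn_toL2 (H1.const a b c)] with ξ h1 h2
      rw [h1, Pi.sub_apply, h2]; rfl
    rw [integral_congr_ae h1, integral_sub (L2.integrable k) (integrable_const c),
      integral_const_vol hab, hc, smul_inv_smul₀ (sub_pos.2 hab).ne', sub_self]
  obtain ⟨w, hwd, hwa, hwb⟩ := H1.exists_primitive hab u 0
  rw [hu0, add_zero] at hwb
  have hkw : ⟪k, u⟫_ℂ = 0 := by
    have h1 := hw w ⟨hwa, hwb⟩
    have h2 := H1.inner_derivL2_add hab G w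
    rw [hwa, hwb, inner_zero_right, inner_zero_right, sub_zero, hG, hwd] at h2
    rw [hwd] at h1
    rw [hk, inner_sub_left]
    linear_combination h1 - h2
  have hcu : ⟪H1.toL2 d a b (H1.const a b c), u⟫_ℂ = 0 := by
    have h2 := H1.inner_derivL2_add hab (H1.const a b c) w
    rw [hwa, hwb, inner_zero_right, inner_zero_right, sub_zero, H1.derivL2_const, hwd,
      inner_zero_left, zero_add] at h2
    exact h2
  have huu : u = 0 := by
    refine (inner_self_eq_zero (𝕜 := ℂ)).1 ?_
    conv_lhs => rw [hu, inner_sub_left]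
    rw [hkw, hcu, sub_zero]
  refine ⟨G + H1.const a b c, ?_, by rw [map_add, hG, H1.derivL2_const, add_zero]⟩
  rw [map_add]
  rw [hu, hk, sub_eq_zero, sub_eq_iff_eq_add] at huu
  rw [huu, add_comm]

/-- The application of a matrix to an `L²`-function. -/
noncomputable abbrev matL2 (a b : ℝ) (P : Matrix (Fin d) (Fin d) ℂ) : L2 d a b →L[ℂ] L2 d a b :=
  (Matrix.toEuclideanCLM (𝕜 := ℂ) P).compLpL 2 (vol a b)

lemma coeFn_matL2 (P : Matrix (Fin d) (Fin d) ℂ) (f : L2 d a b) :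
    matL2 a b P f =ᵐ[vol a b] fun ξ => Matrix.toEuclideanCLM (𝕜 := ℂ) P (f ξ) :=
  ContinuousLinearMap.coeFn_compLpL _ f

lemma inner_toEuclideanCLM (P : Matrix (Fin d) (Fin d) ℂ) (x y : Vec d) :
    ⟪Matrix.toEuclideanCLM (𝕜 := ℂ) P x, y⟫_ℂ = ⟪x, Matrix.toEuclideanCLM (𝕜 := ℂ) Pᴴ y⟫_ℂ := by
  have : Matrix.toEuclideanCLM (𝕜 := ℂ) Pᴴ =
      ContinuousLinearMap.adjoint (Matrix.toEuclideanCLM (𝕜 := ℂ) P) := by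
    rw [← ContinuousLinearMap.star_eq_adjoint, ← map_star, Matrix.star_eq_conjTranspose]
  rw [this, ContinuousLinearMap.adjoint_inner_right]

lemma inner_matL2 (P : Matrix (Fin d) (Fin d) ℂ) (f g : L2 d a b) :
    ⟪matL2 a b P f, g⟫_ℂ = ⟪f, matL2 a b Pᴴ g⟫_ℂ := by
  rw [L2.inner_def, L2.inner_def]
  refine integral_congr_ae ?_
  filter_upwards [coeFn_matL2 P f, coeFn_matL2 Pᴴ g] with ξ h1 h2
  rw [h1, h2, inner_toEuclideanCLM]

lemma matL2_mul (P Q : Matrix (Fin d) (Fin d) ℂ) (f : L2 d a b) :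
    matL2 a b (P * Q) f = matL2 a b P (matL2 a b Q f) := by
  refine Lp.ext ?_
  filter_upwards [coeFn_matL2 P (matL2 a b Q f), coeFn_matL2 Q f, coeFn_matL2 (P * Q) f]
    with ξ h1 h2 h3
  rw [h1, h2, h3, map_mul]; rfl

lemma matL2_one (f : L2 d a b) : matL2 a b 1 f = f := by
  refine Lp.ext ?_
  filter_upwards [coeFn_matL2 1 f] with ξ h1
  rw [h1, map_one]; rfl

lemma matL2_neg (P : Matrix (Fin d) (Fin d) ℂ) (f : L2 d a b) :
    matL2 a b (-P) f = -matL2 a b P f := by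
  refine Lp.ext ?_
  filter_upwards [coeFn_matL2 P f, coeFn_matL2 (-P) f, Lp.coeFn_neg (matL2 a b P f)]
    with ξ h1 h2 h3
  rw [h2, h3, Pi.neg_apply, h1, map_neg]; rfl

/-- `H¹` is stable under the application of matrices. -/
lemma H1.exists_matrix (P : Matrix (Fin d) (Fin d) ℂ) (y : H1 d a b) :
    ∃ z : H1 d a b, (∀ ξ, z.1 ξ = Matrix.toEuclideanCLM (𝕜 := ℂ) P (y.1 ξ)) ∧
      H1.toL2 d a b z = matL2 a b P (H1.toL2 d a b y) ∧
      H1.derivL2 d a b z = matL2 a b P (H1.derivL2 d a b y) := by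
  set L := Matrix.toEuclideanCLM (𝕜 := ℂ) P with hL
  have hac : AbsolutelyContinuousOnInterval (fun ξ => L (y.1 ξ)) a b := by
    refine y.2.1.of_dist_le_add (C := ‖L‖) y.2.1 fun s _ t _ => ?_
    exact (L.dist_le_opNorm _ _).trans (le_add_of_nonneg_right (by positivity))
  have hd : deriv (fun ξ => L (y.1 ξ)) =ᵐ[vol a b] matL2 a b P (H1.derivL2 d a b y) := by
    filter_upwards [ac_ae_differentiableAt y.2.1, H1.coeFn_derivL2 y,
      coeFn_matL2 P (H1.derivL2 d a b y)] with ξ h1 h2 h3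
    rw [h3, h2]
    exact ((L.restrictScalars ℝ).hasFDerivAt.comp_hasDerivAt ξ h1.hasDerivAt).deriv
  refine ⟨⟨_, hac, (memLp_congr_ae hd).2 (Lp.memLp _)⟩, fun _ => rfl, Lp.ext ?_, Lp.ext ?_⟩
  · refine (H1.coeFn_toL2 _).trans ?_
    filter_upwards [H1.coeFn_toL2 y, coeFn_matL2 P (H1.toL2 d a b y)] with ξ h1 h2
    rw [h2, h1]
  · exact (H1.coeFn_derivL2 _).trans hd

lemma diffExpr_apply (P₀ P₁ : Matrix (Fin d) (Fin d) ℂ) (y : H1 d a b) :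
    diffExpr P₀ P₁ y =
      matL2 a b P₀ (H1.toL2 d a b y) + matL2 a b P₁ (H1.derivL2 d a b y) := rfl

variable {P₀ P₁ : Matrix (Fin d) (Fin d) ℂ}

/-- Green's identity for the differential expression `P₀ y + P₁ y'`. -/
lemma inner_diffExpr_add (hab : a < b) (hP₀ : P₀ᴴ = -P₀) (hP₁ : P₁ᴴ = P₁) (y w : H1 d a b) :
    ⟪diffExpr P₀ P₁ y, H1.toL2 d a b w⟫_ℂ + ⟪H1.toL2 d a b y, diffExpr P₀ P₁ w⟫_ℂ =
      ⟪y.1 b, Matrix.toEuclideanCLM (𝕜 := ℂ) P₁ (w.1 b)⟫_ℂ -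
        ⟪y.1 a, Matrix.toEuclideanCLM (𝕜 := ℂ) P₁ (w.1 a)⟫_ℂ := by
  obtain ⟨z, hz, hz1, hz2⟩ := H1.exists_matrix P₁ w
  have h := H1.inner_derivL2_add hab y z
  rw [hz, hz, hz1, hz2] at h
  rw [diffExpr_apply, diffExpr_apply, inner_add_left, inner_add_right, inner_matL2, inner_matL2,
    hP₀, hP₁, matL2_neg, inner_neg_right, ← h]
  ring

/-- The adjoint of the minimal operator is the negative of the maximal operator. -/
lemma exists_diffExpr_eq (hab : a < b) (hP₀ : P₀ᴴ = -P₀) (hP₁ : P₁ᴴ = P₁) (hP₁' : IsUnit P₁)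
    (f h : L2 d a b) (hfh : ∀ w ∈ zeroBoundary d a b,
      ⟪f, H1.toL2 d a b w⟫_ℂ + ⟪h, diffExpr P₀ P₁ w⟫_ℂ = 0) :
    ∃ y : H1 d a b, H1.toL2 d a b y = h ∧ diffExpr P₀ P₁ y = f := by
  have hdet := (Matrix.isUnit_iff_isUnit_det _).1 hP₁'
  -- The hypothesis says that P₁h has weak derivative f - P₀h; invertibility of P₁ then returns to
  -- h.
  obtain ⟨z, hz1, hz2⟩ := H1.exists_of_weak_deriv hab (matL2 a b P₁ h) (f - matL2 a b P₀ h)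
    fun w hw => by
      rw [← hfh w hw, diffExpr_apply, inner_add_right, inner_sub_left, inner_matL2, inner_matL2,
        hP₀, hP₁, matL2_neg, inner_neg_right]
      ring
  obtain ⟨y, -, hy1, hy2⟩ := H1.exists_matrix P₁⁻¹ z
  have hyh : H1.toL2 d a b y = h := by
    rw [hy1, hz1, ← matL2_mul, Matrix.nonsing_inv_mul _ hdet, matL2_one]
  refine ⟨y, hyh, ?_⟩
  rw [diffExpr_apply, hyh, hy2, hz2, ← matL2_mul, Matrix.mul_nonsing_inv _ hdet, matL2_one,
    add_sub_cancel]

end PHS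

/-! ### Linear algebra of the indefinite form Σ -/

namespace PHS

variable {d : ℕ}

/-- The space `ℂ²ᵈ` of boundary values. -/
abbrev Vec2 (d : ℕ) : Type := EuclideanSpace ℂ (Fin d ⊕ Fin d)

/-- The block matrix `Σ` as a linear map. -/
noncomputable def sigmaLin (d : ℕ) : Vec2 d →ₗ[ℂ] Vec2 d := Matrix.toEuclideanLin (sigmaMatrix d)

lemma sigmaLin_apply (z : Vec2 d) :
    sigmaLin d z = WithLp.toLp 2 (Sum.elim (z.ofLp ∘ Sum.inr) (z.ofLp ∘ Sum.inl)) := by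
  rw [sigmaLin, Matrix.toLpLin_apply, sigmaMatrix, Matrix.fromBlocks_mulVec]
  simp

lemma sigmaLin_sigmaLin (z : Vec2 d) : sigmaLin d (sigmaLin d z) = z := by
  ext (i | i) <;> simp [sigmaLin_apply]

lemma sigmaMatrix_isHermitian : (sigmaMatrix d).IsHermitian := by
  simp [sigmaMatrix, Matrix.IsHermitian, Matrix.fromBlocks_conjTranspose]

lemma inner_sigmaLin_left (x y : Vec2 d) : ⟪sigmaLin d x, y⟫_ℂ = ⟪x, sigmaLin d y⟫_ℂ :=
  Matrix.isSymmetric_toEuclideanLin_iff.2 sigmaMatrix_isHermitian x y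

lemma inner_sigmaLin_sigmaLin (x : Vec2 d) :
    ⟪sigmaLin d x, sigmaLin d (sigmaLin d x)⟫_ℂ = ⟪x, sigmaLin d x⟫_ℂ := by
  rw [inner_sigmaLin_left, sigmaLin_sigmaLin]

lemma finrank_vec2 : Module.finrank ℂ (Vec2 d) = d + d := by
  rw [finrank_euclideanSpace, Fintype.card_sum, Fintype.card_fin]

/-- The embedding `u ↦ (u, s u)`, on whose range the quadratic form of `Σ` has the sign of `s`. -/
noncomputable def diagEmbedding (d : ℕ) (s : ℝ) : Vec d →ₗ[ℂ] Vec2 d where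
  toFun u := WithLp.toLp 2 (Sum.elim u.ofLp ((s : ℂ) • u.ofLp))
  map_add' u v := by ext (i | i) <;> simp
  map_smul' c u := by ext (i | i) <;> simp [mul_left_comm]

lemma diagEmbedding_injective (s : ℝ) : Function.Injective (diagEmbedding d s) := fun u v h => by
  ext i
  exact congrFun (congrArg WithLp.ofLp h) (Sum.inl i)

lemma inner_diagEmbedding (s : ℝ) (u : Vec d) :
    (⟪diagEmbedding d s u, sigmaLin d (diagEmbedding d s u)⟫_ℂ).re = 2 * s * ‖u‖ ^ 2 := by
  have h : ⟪diagEmbedding d s u, sigmaLin d (diagEmbedding d s u)⟫_ℂ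
      = ((2 * s : ℝ) : ℂ) * ⟪u, u⟫_ℂ := by
    rw [PiLp.inner_apply, PiLp.inner_apply, Fintype.sum_sum_type, Finset.mul_sum,
      ← Finset.sum_add_distrib]
    refine Finset.sum_congr rfl fun i _ => ?_
    simp only [sigmaLin_apply, diagEmbedding]
    simp
    linear_combination (2 * s : ℂ) * Complex.mul_conj' (u.ofLp i)
  rw [h, inner_self_eq_norm_sq_to_K, Complex.re_ofReal_mul]
  norm_cast

/-- On the d-dimensional space of vectors (u, su), s times the form equals 2s²‖u‖². It therefore
meets U only in 0, leaving at most 2d - d dimensions for U. -/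
lemma finrank_le_of_sign (s : ℝ) (hs : s ≠ 0) (U : Submodule ℂ (Vec2 d))
    (hU : ∀ x ∈ U, s * (⟪x, sigmaLin d x⟫_ℂ).re ≤ 0) : Module.finrank ℂ U ≤ d := by
  have hdisj : Disjoint U (LinearMap.range (diagEmbedding d s)) := by
    rw [Submodule.disjoint_def]
    rintro _ hx ⟨u, rfl⟩
    have h := hU _ hx
    rw [inner_diagEmbedding, show s * (2 * s * ‖u‖ ^ 2) = 2 * (s * ‖u‖) ^ 2 by ring] at h
    have h1 : s * ‖u‖ = 0 := pow_eq_zero_iff two_ne_zero |>.1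
      (le_antisymm (by linarith) (by positivity))
    rw [norm_eq_zero.1 ((mul_eq_zero.1 h1).resolve_left hs), map_zero]
  have h := Submodule.finrank_add_finrank_le_of_disjoint hdisj
  rw [LinearMap.finrank_range_of_inj (diagEmbedding_injective s), finrank_vec2,
    finrank_euclideanSpace, Fintype.card_fin] at h
  omega

/-- The vectors orthogonal, with respect to `Σ`, to a maximal nonnegative subspace are
nonpositive. -/
lemma re_inner_sigmaLin_nonpos {U : Submodule ℂ (Vec2 d)} (hUd : Module.finrank ℂ U = d)
    (hU : ∀ x ∈ U, 0 ≤ (⟪x, sigmaLin d x⟫_ℂ).re) {z : Vec2 d}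
    (hz : ∀ x ∈ U, ⟪x, sigmaLin d z⟫_ℂ = 0) : (⟪z, sigmaLin d z⟫_ℂ).re ≤ 0 := by
  -- If z were positive, adjoining it to U would give a nonnegative subspace of dimension greater
  -- than d, since the mixed terms vanish.
  by_contra! hpos
  have hzU : z ∉ U := fun h => by rw [hz z h] at hpos; exact lt_irrefl _ hpos
  have hlt : U < U ⊔ Submodule.span ℂ {z} :=
    lt_of_le_of_ne le_sup_left fun h => hzU (h ▸ Submodule.mem_sup_right
      (Submodule.mem_span_singleton_self z))
  have h1 := Submodule.finrank_lt_finrank_of_lt hlt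
  have h2 : Module.finrank ℂ ↥(U ⊔ Submodule.span ℂ {z}) ≤ d := by
    refine finrank_le_of_sign (-1) (by norm_num) _ fun x hx => ?_
    obtain ⟨u, hu, w, hw, rfl⟩ := Submodule.mem_sup.1 hx
    obtain ⟨c, rfl⟩ := Submodule.mem_span_singleton.1 hw
    have h3 : ⟪z, sigmaLin d u⟫_ℂ = 0 := by
      rw [← inner_sigmaLin_left, ← inner_conj_symm, hz u hu, map_zero]
    have h4 : ⟪u + c • z, sigmaLin d (u + c • z)⟫_ℂ
        = ⟪u, sigmaLin d u⟫_ℂ + ((Complex.normSq c : ℝ) : ℂ) * ⟪z, sigmaLin d z⟫_ℂ := by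
      rw [map_add, map_smul, inner_add_left, inner_add_right, inner_add_right, inner_smul_left,
        inner_smul_left, inner_smul_right, inner_smul_right, hz u hu, h3,
        Complex.normSq_eq_conj_mul_self]
      ring
    rw [h4, Complex.add_re, Complex.re_ofReal_mul]
    have := hU u hu
    have := mul_nonneg (Complex.normSq_nonneg c) hpos.le
    linarith
  omega

/-- A maximal nonpositive subspace has dimension `d`. -/
lemma finrank_eq_of_maximal {K : Submodule ℂ (Vec2 d)}
    (hK : ∀ x ∈ K, (⟪x, sigmaLin d x⟫_ℂ).re ≤ 0)
    (hK' : ∀ z, (∀ x ∈ K, ⟪x, sigmaLin d z⟫_ℂ = 0) → 0 ≤ (⟪z, sigmaLin d z⟫_ℂ).re) :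
    Module.finrank ℂ K = d := by
  have h1 : Module.finrank ℂ K ≤ d :=
    finrank_le_of_sign 1 one_ne_zero K fun x hx => by rw [one_mul]; exact hK x hx
  -- For x orthogonal to K, Σx is Σ-orthogonal to K, and Σ preserves the form; so the form is
  -- nonnegative on the complement. Both dimensions are at most d and add up to 2d.
  have h2 : Module.finrank ℂ Kᗮ ≤ d := by
    refine finrank_le_of_sign (-1) (by norm_num) _ fun x hx => ?_
    have h := hK' (sigmaLin d x) fun y hy => by
      rw [sigmaLin_sigmaLin]; exact (Submodule.mem_orthogonal _ _).1 hx y hy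
    rw [inner_sigmaLin_sigmaLin] at h
    linarith
  have h3 := Submodule.finrank_add_finrank_orthogonal K
  rw [finrank_vec2] at h3
  omega

variable {W : Matrix (Fin d) (Fin d ⊕ Fin d) ℂ}

/-- Positivity of WΣW⋆ thus means that Σ is nonnegative on the range of W⋆, the orthogonal
complement of ker W. -/
lemma star_dotProduct_mul_sigma_mul (W : Matrix (Fin d) (Fin d ⊕ Fin d) ℂ) (k : Fin d → ℂ) :
    star k ⬝ᵥ ((W * sigmaMatrix d * Wᴴ) *ᵥ k) =
      ⟪LinearMap.adjoint (Matrix.toEuclideanLin W) (WithLp.toLp 2 k),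
        sigmaLin d (LinearMap.adjoint (Matrix.toEuclideanLin W) (WithLp.toLp 2 k))⟫_ℂ := by
  rw [LinearMap.adjoint_inner_left, ← Matrix.toEuclideanLin_conjTranspose_eq_adjoint,
    EuclideanSpace.inner_eq_star_dotProduct, dotProduct_comm]
  simp [sigmaLin, Matrix.toLpLin_apply, Matrix.mulVec_mulVec, Matrix.mul_assoc]

lemma finrank_range_toEuclideanLin {m n : Type*} [Fintype m] [Fintype n] [DecidableEq n]
    (M : Matrix m n ℂ) :
    Module.finrank ℂ (LinearMap.range (Matrix.toEuclideanLin M)) = M.rank := by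
  rw [Matrix.rank_eq_finrank_range_toLin M (PiLp.basisFun 2 ℂ m) (PiLp.basisFun 2 ℂ n),
    ← Matrix.toLpLin_eq_toLin 2 2]

lemma finrank_range_adjoint (hW : W.rank = d) :
    Module.finrank ℂ (LinearMap.range (LinearMap.adjoint (Matrix.toEuclideanLin W))) = d := by
  rw [← Matrix.toEuclideanLin_conjTranspose_eq_adjoint, finrank_range_toEuclideanLin,
    Matrix.rank_conjTranspose, hW]

lemma Admissible.nonneg (hW : Admissible W) {x : Vec2 d}
    (hx : x ∈ (LinearMap.ker (Matrix.toEuclideanLin W))ᗮ) : 0 ≤ (⟪x, sigmaLin d x⟫_ℂ).re := by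
  rw [LinearMap.orthogonal_ker] at hx
  obtain ⟨k, rfl⟩ := hx
  have h := hW.2.dotProduct_mulVec_nonneg k.ofLp
  rw [star_dotProduct_mul_sigma_mul] at h
  exact (Complex.nonneg_iff.1 h).1

/-- The kernel of an admissible matrix is nonpositive with respect to `Σ`. -/
lemma Admissible.nonpos (hW : Admissible W) {z : Vec2 d}
    (hz : Matrix.toEuclideanLin W z = 0) : (⟪z, sigmaLin d z⟫_ℂ).re ≤ 0 := by
  have hinj : Function.Injective (sigmaLin d) := fun x y h => by
    rw [← sigmaLin_sigmaLin x, h, sigmaLin_sigmaLin]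
  -- Σ maps the complement of ker W to a nonnegative space of dimension d that is Σ-orthogonal to
  -- ker W.
  refine re_inner_sigmaLin_nonpos
    (U := (LinearMap.ker (Matrix.toEuclideanLin W))ᗮ.map (sigmaLin d)) ?_ ?_ ?_
  · rw [← (Submodule.equivMapOfInjective _ hinj _).finrank_eq, LinearMap.orthogonal_ker,
      finrank_range_adjoint hW.1]
  · rintro _ ⟨x, hx, rfl⟩
    rw [inner_sigmaLin_sigmaLin]
    exact hW.nonneg hx
  · rintro _ ⟨x, hx, rfl⟩
    rw [inner_sigmaLin_left, sigmaLin_sigmaLin]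
    exact (Submodule.mem_orthogonal' _ _).1 hx z (LinearMap.mem_ker.2 hz)

/-- Every maximal nonpositive subspace is the kernel of an admissible matrix. -/
lemma exists_admissible {K : Submodule ℂ (Vec2 d)}
    (hK : ∀ x ∈ K, (⟪x, sigmaLin d x⟫_ℂ).re ≤ 0)
    (hK' : ∀ z, (∀ x ∈ K, ⟪x, sigmaLin d z⟫_ℂ = 0) → 0 ≤ (⟪z, sigmaLin d z⟫_ℂ).re) :
    ∃ W : Matrix (Fin d) (Fin d ⊕ Fin d) ℂ, Admissible W ∧
      LinearMap.ker (Matrix.toEuclideanLin W) = K := by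
  have hKd := finrank_eq_of_maximal hK hK'
  have hKd' : Module.finrank ℂ Kᗮ = d := by
    have h3 := Submodule.finrank_add_finrank_orthogonal K
    rw [finrank_vec2] at h3
    omega
  let e := (stdOrthonormalBasis ℂ Kᗮ).reindex (finCongr hKd')
  -- The rows are the conjugates of an orthonormal basis of the complement of K, so that Wz lists
  -- the numbers ⟨eᵢ, z⟩.
  let W : Matrix (Fin d) (Fin d ⊕ Fin d) ℂ := Matrix.of fun i j => star ((e i : Vec2 d).ofLp j)
  have hWz : ∀ z i, (Matrix.toEuclideanLin W z).ofLp i = ⟪(e i : Vec2 d), z⟫_ℂ := fun z i => by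
    rw [Matrix.toLpLin_apply, EuclideanSpace.inner_eq_star_dotProduct, dotProduct_comm]
    rfl
  have hker : LinearMap.ker (Matrix.toEuclideanLin W) = K := by
    ext z
    rw [LinearMap.mem_ker, ← K.orthogonal_orthogonal, Submodule.mem_orthogonal]
    refine ⟨fun h y hy => ?_, fun h => ?_⟩
    · rw [← inner_conj_symm, map_eq_zero]
      have h1 : ∀ i, ⟪(e i : Vec2 d), z⟫_ℂ = 0 := fun i => by rw [← hWz, h]; rfl
      have h2 : y = ∑ i, ⟪e i, ⟨y, hy⟩⟫_ℂ • (e i : Vec2 d) := by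
        have := congrArg Subtype.val (e.sum_repr' ⟨y, hy⟩)
        simpa using this.symm
      rw [h2, inner_sum]
      refine Finset.sum_eq_zero fun i _ => ?_
      rw [inner_smul_right, inner_eq_zero_symm.1 (h1 i), mul_zero]
    · ext i
      rw [hWz]
      exact h _ (e i).2
  have hrank : W.rank = d := by
    have h1 := LinearMap.finrank_range_add_finrank_ker (Matrix.toEuclideanLin W)
    rw [hker, hKd, finrank_vec2, finrank_range_toEuclideanLin] at h1
    omega
  refine ⟨W, ⟨hrank, Matrix.PosSemidef.of_dotProduct_mulVec_nonneg ?_ fun k => ?_⟩, hker⟩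
  · rw [Matrix.IsHermitian, Matrix.conjTranspose_mul, Matrix.conjTranspose_mul,
      Matrix.conjTranspose_conjTranspose, sigmaMatrix_isHermitian.eq, Matrix.mul_assoc]
  · rw [star_dotProduct_mul_sigma_mul]
    set x := LinearMap.adjoint (Matrix.toEuclideanLin W) (WithLp.toLp 2 k)
    have hx : x ∈ Kᗮ := by
      rw [← hker, LinearMap.orthogonal_ker]; exact LinearMap.mem_range_self _ _
    have h := hK' (sigmaLin d x) fun y hy => by
      rw [sigmaLin_sigmaLin]; exact (Submodule.mem_orthogonal _ _).1 hx y hy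
    rw [inner_sigmaLin_sigmaLin] at h
    refine Complex.nonneg_iff.2 ⟨h, ?_⟩
    have h1 : (starRingEnd ℂ) ⟪x, sigmaLin d x⟫_ℂ = ⟪x, sigmaLin d x⟫_ℂ := by
      rw [inner_conj_symm, inner_sigmaLin_left]
    exact (Complex.conj_eq_iff_im.1 h1).symm

end PHS

/-! ### Surjectivity from closedness -/

/-- For a closed dissipative operator `B`, the operator `c - B` is onto if its range has trivial
orthogonal complement. -/
lemma LinearPMap.IsDissipative.surjective_of_isClosed {X : Type*} [NormedAddCommGroup X]
    [InnerProductSpace ℂ X] [CompleteSpace X] {B : X →ₗ.[ℂ] X} (hB : B.IsDissipative)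
    (hclosed : _root_.IsClosed (B.graph : Set (X × X))) {c : ℝ} (hc : 0 < c)
    (horth : ∀ v : X, (∀ x z, (x, z) ∈ B.graph → ⟪v, (c : ℂ) • x - z⟫_ℂ = 0) → v = 0) (f : X) :
    ∃ x : B.domain, (c : ℂ) • (x : X) - B x = f := by
  have : CompleteSpace B.graph := hclosed.completeSpace_coe
  let F : B.graph →L[ℂ] X :=
    ((c : ℂ) • ContinuousLinearMap.fst ℂ X X - ContinuousLinearMap.snd ℂ X X) ∘L B.graph.subtypeL
  have hF : ∀ p, F p = (c : ℂ) • p.1.1 - p.1.2 := fun p => rfl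
  -- F is bounded below on the complete graph, so its range is closed. The components of (x, z) are
  -- bounded by c⁻¹‖F p‖ and 2‖F p‖.
  have hbound : ∀ p, ‖p‖ ≤ ((c⁻¹ + 2).toNNReal : ℝ) * ‖F p‖ := fun p => by
    obtain ⟨y, hy, hz⟩ := B.mem_graph_iff.1 p.2
    have h1 : c * ‖p.1.1‖ ≤ ‖F p‖ := by
      rw [hF, ← hy, ← hz]; exact hB.mul_norm_le c y
    have h2 : ‖p.1.1‖ ≤ c⁻¹ * ‖F p‖ := by
      rw [inv_mul_eq_div, le_div_iff₀' hc]; exact h1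
    have h3 : ‖p.1.2‖ ≤ 2 * ‖F p‖ := by
      have h4 : p.1.2 = (c : ℂ) • p.1.1 - F p := by rw [hF]; abel
      have h5 := norm_sub_le ((c : ℂ) • p.1.1) (F p)
      rw [← h4, norm_smul, Complex.norm_real, Real.norm_of_nonneg hc.le] at h5
      linarith
    rw [Real.coe_toNNReal _ (by positivity)]
    have h6 : 0 ≤ c⁻¹ * ‖F p‖ := by positivity
    have h7 := norm_nonneg (F p)
    change ‖p.1‖ ≤ _
    rw [Prod.norm_def, add_mul]
    exact max_le (by linarith) (by linarith)
  have hrange : _root_.IsClosed (LinearMap.range F.toLinearMap : Set X) :=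
    (AddMonoidHomClass.antilipschitz_of_bound F hbound).isClosed_range F.uniformContinuous
  have htop : LinearMap.range F.toLinearMap = ⊤ := by
    rw [← hrange.submodule_topologicalClosure_eq, Submodule.topologicalClosure_eq_top_iff,
      Submodule.eq_bot_iff]
    intro v hv
    refine horth v fun x z hxz => ?_
    exact (Submodule.mem_orthogonal' _ _).1 hv _ ⟨⟨(x, z), hxz⟩, rfl⟩
  obtain ⟨p, hp⟩ := LinearMap.range_eq_top.1 htop f
  obtain ⟨y, hy, hz⟩ := B.mem_graph_iff.1 p.2
  exact ⟨y, by rw [hy, hz]; exact hp⟩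

/-! ### The energy space and boundary values -/

namespace PHS

variable {d : ℕ} {a b : ℝ}

section EnergySpace

variable (ℋ : EnergyDensity d a b)

lemma EnergyDensity.exists_norm_mulL2_le :
    ∃ M : ℝ, ∀ x : L2 d a b, ‖ℋ.mulL2 x‖ ≤ M * ‖x‖ := by
  obtain ⟨M, hM⟩ := ℋ.norm_le
  refine ⟨M, fun x => Lp.norm_le_mul_norm_of_ae_le_mul ?_⟩
  filter_upwards [hM, ℋ.coeFn_mulL2 x] with ξ h1 h2
  rw [h2]
  exact (ContinuousLinearMap.le_opNorm _ _).trans (by gcongr)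

lemma EnergySpace.norm_sq (x : EnergySpace ℋ) :
    ‖x‖ ^ 2 = (⟪EnergySpace.toL2 ℋ x, ℋ.mulL2 (EnergySpace.toL2 ℋ x)⟫_ℂ).re := by
  rw [← EnergySpace.inner_def, inner_self_eq_norm_sq_to_K]
  norm_cast

lemma EnergySpace.exists_norm_toL2_le :
    ∃ C : ℝ, ∀ x : EnergySpace ℋ, ‖EnergySpace.toL2 ℋ x‖ ≤ C * ‖x‖ := by
  obtain ⟨m, hm, h⟩ := ℋ.coercive
  refine ⟨√m⁻¹, fun x => ?_⟩
  have h1 := h (EnergySpace.toL2 ℋ x)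
  rw [← EnergySpace.norm_sq] at h1
  refine (sq_le_sq₀ (norm_nonneg _) (by positivity)).1 ?_
  rw [mul_pow, Real.sq_sqrt (by positivity), inv_mul_eq_div, le_div_iff₀' hm]
  exact h1

lemma EnergySpace.exists_norm_toL2_symm_le :
    ∃ C : ℝ, ∀ x : L2 d a b, ‖(EnergySpace.toL2 ℋ).symm x‖ ≤ C * ‖x‖ := by
  obtain ⟨M, hM⟩ := ℋ.exists_norm_mulL2_le
  refine ⟨√(max M 0), fun x => ?_⟩
  refine (sq_le_sq₀ (norm_nonneg _) (by positivity)).1 ?_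
  rw [EnergySpace.norm_sq, LinearEquiv.apply_symm_apply, mul_pow, Real.sq_sqrt (le_max_right _ _)]
  refine (Complex.re_le_norm _).trans ((norm_inner_le_norm _ _).trans ?_)
  calc ‖x‖ * ‖ℋ.mulL2 x‖ ≤ ‖x‖ * (max M 0 * ‖x‖) := by
        gcongr
        exact (hM x).trans (by gcongr; exact le_max_left _ _)
    _ = max M 0 * ‖x‖ ^ 2 := by ring

/-- The identity map `X → L²` as a continuous linear equivalence. -/
noncomputable def EnergySpace.toL2L : EnergySpace ℋ ≃L[ℂ] L2 d a b :=
  (EnergySpace.toL2 ℋ).toContinuousLinearEquivOfBounds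
    (EnergySpace.exists_norm_toL2_le ℋ).choose (EnergySpace.exists_norm_toL2_symm_le ℋ).choose
    (EnergySpace.exists_norm_toL2_le ℋ).choose_spec
    (EnergySpace.exists_norm_toL2_symm_le ℋ).choose_spec

instance : CompleteSpace (EnergySpace ℋ) :=
  (completeSpace_congr (e := (EnergySpace.toL2L ℋ).toEquiv)
    (EnergySpace.toL2L ℋ).isUniformEmbedding).2 inferInstance

/-- Riesz representation for the energy inner product: the vector representing w ↦ ⟨y, w⟩ is a
preimage of y. No pointwise inverse of `ℋ`, nor its measurability, is needed. -/
lemma EnergySpace.mulH_surjective : Function.Surjective (EnergySpace.mulH ℋ) := fun y => by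
  let φ : EnergySpace ℋ →L[ℂ] ℂ := innerSL ℂ y ∘L (EnergySpace.toL2L ℋ : EnergySpace ℋ →L[ℂ] _)
  refine ⟨(InnerProductSpace.toDual ℂ (EnergySpace ℋ)).symm φ, ?_⟩
  refine ext_inner_right ℂ fun w => ?_
  have h : ⟪(InnerProductSpace.toDual ℂ (EnergySpace ℋ)).symm φ, (EnergySpace.toL2 ℋ).symm w⟫_ℂ
      = φ ((EnergySpace.toL2 ℋ).symm w) := InnerProductSpace.toDual_symm_apply
  rw [EnergySpace.inner_def, LinearEquiv.apply_symm_apply, ← ℋ.inner_mulL2] at h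
  exact h

end EnergySpace

/-- The boundary values `(Γ₁ y, Γ₂ y)`. -/
noncomputable def H1.trace (P₁ : Matrix (Fin d) (Fin d) ℂ) : H1 d a b →ₗ[ℂ] Vec2 d where
  toFun y := WithLp.toLp 2 (Sum.elim (Γ₁ P₁ y) (Γ₂ y))
  map_add' y z := by ext (i | i) <;> simp
  map_smul' c y := by ext (i | i) <;> simp

variable {P₀ P₁ : Matrix (Fin d) (Fin d) ℂ}

/-- The products of values at different endpoints cancel; those at the same endpoint occur twice,
which the squared factor 1/√2 compensates. -/
lemma H1.inner_trace (hP₁ : P₁ᴴ = P₁) (y w : H1 d a b) :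
    ⟪H1.trace P₁ y, sigmaLin d (H1.trace P₁ w)⟫_ℂ =
      ⟪y.1 b, Matrix.toEuclideanCLM (𝕜 := ℂ) P₁ (w.1 b)⟫_ℂ -
        ⟪y.1 a, Matrix.toEuclideanCLM (𝕜 := ℂ) P₁ (w.1 a)⟫_ℂ := by
  have hΓ₁ : ∀ u : H1 d a b, WithLp.toLp 2 (Γ₁ P₁ u) =
      ((1 / √2 : ℝ) : ℂ) • Matrix.toEuclideanCLM (𝕜 := ℂ) P₁ (u.1 b - u.1 a) := fun u => rfl
  have hΓ₂ : ∀ u : H1 d a b, WithLp.toLp 2 (Γ₂ u) =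
      ((1 / √2 : ℝ) : ℂ) • (u.1 b + u.1 a) := fun u => rfl
  have h : ⟪H1.trace P₁ y, sigmaLin d (H1.trace P₁ w)⟫_ℂ =
      ⟪(WithLp.toLp 2 (Γ₁ P₁ y) : Vec d), WithLp.toLp 2 (Γ₂ w)⟫_ℂ +
        ⟪(WithLp.toLp 2 (Γ₂ y) : Vec d), WithLp.toLp 2 (Γ₁ P₁ w)⟫_ℂ := by
    rw [sigmaLin_apply, PiLp.inner_apply, Fintype.sum_sum_type]
    rfl
  have hs : ((1 / √2 : ℝ) : ℂ) * ((1 / √2 : ℝ) : ℂ) = 1 / 2 := by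
    rw [← Complex.ofReal_mul, div_mul_div_comm, Real.mul_self_sqrt (by norm_num)]
    norm_num
  rw [h, hΓ₁, hΓ₂, hΓ₁, hΓ₂]
  simp only [inner_smul_left, inner_smul_right, Complex.conj_ofReal,
    inner_toEuclideanCLM, hP₁, map_sub, inner_add_left, inner_add_right, inner_sub_left,
    inner_sub_right]
  linear_combination 2 * (⟪y.1 b, Matrix.toEuclideanCLM (𝕜 := ℂ) P₁ (w.1 b)⟫_ℂ -
    ⟪y.1 a, Matrix.toEuclideanCLM (𝕜 := ℂ) P₁ (w.1 a)⟫_ℂ) * hs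

lemma mulVec_injective_of_isUnit (hP₁' : IsUnit P₁) : Function.Injective P₁.mulVec :=
  Matrix.mulVec_injective_iff_isUnit.2 hP₁'

lemma H1.trace_eq_zero_iff (hP₁' : IsUnit P₁) (y : H1 d a b) :
    H1.trace P₁ y = 0 ↔ y ∈ zeroBoundary d a b := by
  have h2 : ((1 / √2 : ℝ) : ℂ) ≠ 0 := Complex.ofReal_ne_zero.2 (by positivity)
  constructor
  · intro h
    have h1 : Γ₁ P₁ y = 0 := funext fun i => congrFun (congrArg WithLp.ofLp h) (Sum.inl i)
    have h3 : Γ₂ y = 0 := funext fun i => congrFun (congrArg WithLp.ofLp h) (Sum.inr i)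
    have h4 : (y.1 b).ofLp - (y.1 a).ofLp = 0 := mulVec_injective_of_isUnit hP₁' (by
      rw [Matrix.mulVec_zero]; exact (smul_eq_zero.1 h1).resolve_left h2)
    have h5 : (y.1 b).ofLp + (y.1 a).ofLp = 0 := (smul_eq_zero.1 h3).resolve_left h2
    have h6 : ∀ i, (y.1 a).ofLp i = 0 ∧ (y.1 b).ofLp i = 0 := fun i => by
      have e1 : (y.1 b).ofLp i - (y.1 a).ofLp i = 0 := congrFun h4 i
      have e2 : (y.1 b).ofLp i + (y.1 a).ofLp i = 0 := congrFun h5 i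
      exact ⟨by linear_combination (e2 - e1) / 2, by linear_combination (e1 + e2) / 2⟩
    exact ⟨by ext i; exact (h6 i).1, by ext i; exact (h6 i).2⟩
  · rintro ⟨ha, hb⟩
    ext (i | i) <;> simp [H1.trace, Γ₁, Γ₂, ha, hb]

lemma H1.trace_surjective (hab : a < b) (hP₁' : IsUnit P₁) :
    Function.Surjective (H1.trace (a := a) (b := b) P₁) := by
  intro z
  have hdet := (Matrix.isUnit_iff_isUnit_det _).1 hP₁'
  have h2 : (√2 : ℂ) ≠ 0 := Complex.ofReal_ne_zero.2 (by positivity)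
  set u : Fin d → ℂ := (√2 : ℂ) • (P₁⁻¹ *ᵥ (z.ofLp ∘ Sum.inl)) with hu
  set v : Fin d → ℂ := (√2 : ℂ) • (z.ofLp ∘ Sum.inr) with hv
  obtain ⟨y, ha, hb⟩ := H1.exists_boundary hab
    (WithLp.toLp 2 ((1 / 2 : ℂ) • (v - u)) : Vec d) (WithLp.toLp 2 ((1 / 2 : ℂ) • (v + u)))
  refine ⟨y, ?_⟩
  have h3 : (y.1 b).ofLp - (y.1 a).ofLp = u := by
    rw [ha, hb]; ext i; simp; ring
  have h4 : (y.1 b).ofLp + (y.1 a).ofLp = v := by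
    rw [ha, hb]; ext i; simp; ring
  have h5 : Γ₁ P₁ y = z.ofLp ∘ Sum.inl := by
    change ((1 / √2 : ℝ) : ℂ) • (P₁ *ᵥ ((y.1 b).ofLp - (y.1 a).ofLp)) = _
    rw [h3, hu, Matrix.mulVec_smul, Matrix.mulVec_mulVec, Matrix.mul_nonsing_inv _ hdet,
      Matrix.one_mulVec, smul_smul]
    simp [h2]
  have h6 : Γ₂ y = z.ofLp ∘ Sum.inr := by
    change ((1 / √2 : ℝ) : ℂ) • ((y.1 b).ofLp + (y.1 a).ofLp) = _
    rw [h4, hv, smul_smul]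
    simp [h2]
  ext (i | i)
  · exact congrFun h5 i
  · exact congrFun h6 i

lemma boundaryCondition_eq (W : Matrix (Fin d) (Fin d ⊕ Fin d) ℂ) :
    boundaryCondition (a := a) (b := b) P₁ W =
      (LinearMap.ker (Matrix.toEuclideanLin W)).comap (H1.trace P₁) := by
  ext y
  rw [Submodule.mem_comap, LinearMap.mem_ker, Matrix.toLpLin_apply]
  exact (WithLp.toLp_eq_zero 2).symm

end PHS

/-! ### Boundary conditions and contraction semigroups -/

namespace PHS

variable {d : ℕ} {a b : ℝ} {P₀ P₁ : Matrix (Fin d) (Fin d) ℂ} {ℋ : EnergyDensity d a b}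

/-- `y ∈ H¹` represents `ℋx`, and `z` is the image of `x` under the maximal operator
`x ↦ P₀ℋx + P₁(ℋx)'`. -/
def IsRep (P₀ P₁ : Matrix (Fin d) (Fin d) ℂ) (x z : EnergySpace ℋ) (y : H1 d a b) : Prop :=
  H1.toL2 d a b y = EnergySpace.mulH ℋ x ∧ diffExpr P₀ P₁ y = EnergySpace.toL2 ℋ z

lemma IsRep.sub {x z x' z' : EnergySpace ℋ} {y y' : H1 d a b} (h : IsRep P₀ P₁ x z y)
    (h' : IsRep P₀ P₁ x' z' y') : IsRep P₀ P₁ (x - x') (z - z') (y - y') :=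
  ⟨by rw [map_sub, map_sub, h.1, h'.1], by rw [map_sub, map_sub, h.2, h'.2]⟩

lemma IsRep.add {x z x' z' : EnergySpace ℋ} {y y' : H1 d a b} (h : IsRep P₀ P₁ x z y)
    (h' : IsRep P₀ P₁ x' z' y') : IsRep P₀ P₁ (x + x') (z + z') (y + y') :=
  ⟨by rw [map_add, map_add, h.1, h'.1], by rw [map_add, map_add, h.2, h'.2]⟩

lemma IsRep.smul (c : ℂ) {x z : EnergySpace ℋ} {y : H1 d a b} (h : IsRep P₀ P₁ x z y) :
    IsRep P₀ P₁ (c • x) (c • z) (c • y) :=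
  ⟨by rw [map_smul, map_smul, h.1], by rw [map_smul, map_smul, h.2]⟩

lemma exists_isRep (P₀ P₁ : Matrix (Fin d) (Fin d) ℂ) (ℋ : EnergyDensity d a b) (y : H1 d a b) :
    ∃ x z : EnergySpace ℋ, IsRep P₀ P₁ x z y := by
  obtain ⟨x, hx⟩ := EnergySpace.mulH_surjective ℋ (H1.toL2 d a b y)
  exact ⟨x, (EnergySpace.toL2 ℋ).symm (diffExpr P₀ P₁ y), hx.symm,
    ((EnergySpace.toL2 ℋ).apply_symm_apply _).symm⟩

lemma mem_phOperator_graph {V : Submodule ℂ (H1 d a b)} {x z : EnergySpace ℋ} :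
    (x, z) ∈ (phOperator P₀ P₁ ℋ V).graph ↔ ∃ y ∈ V, IsRep P₀ P₁ x z y := by
  rw [LinearPMap.mem_graph_iff]
  constructor
  · rintro ⟨u, rfl, rfl⟩
    obtain ⟨y, hy, hyu⟩ := (mem_phOperator_domain P₀ P₁ ℋ V u).1 u.2
    exact ⟨y, hy, hyu, (phOperator_apply P₀ P₁ ℋ V u y hyu).symm⟩
  · rintro ⟨y, hy, h1, h2⟩
    let u : (phOperator P₀ P₁ ℋ V).domain :=
      ⟨x, (mem_phOperator_domain P₀ P₁ ℋ V x).2 ⟨y, hy, h1⟩⟩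
    refine ⟨u, rfl, (EnergySpace.toL2 ℋ).injective ?_⟩
    rw [← h2]
    exact phOperator_apply P₀ P₁ ℋ V u y h1

lemma phOperator_mono (P₀ P₁ : Matrix (Fin d) (Fin d) ℂ) (ℋ : EnergyDensity d a b)
    {V V' : Submodule ℂ (H1 d a b)} (h : V ≤ V') :
    phOperator P₀ P₁ ℋ V ≤ phOperator P₀ P₁ ℋ V' := by
  refine LinearPMap.le_of_le_graph ?_
  rintro ⟨x, z⟩ hxz
  obtain ⟨y, hy, hr⟩ := mem_phOperator_graph.1 hxz
  exact mem_phOperator_graph.2 ⟨y, h hy, hr⟩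

/-- Green's identity in the energy space. -/
lemma IsRep.inner_add (hab : a < b) (hP₀ : P₀ᴴ = -P₀) (hP₁ : P₁ᴴ = P₁)
    {x z x' z' : EnergySpace ℋ} {y y' : H1 d a b} (h : IsRep P₀ P₁ x z y)
    (h' : IsRep P₀ P₁ x' z' y') :
    ⟪z, x'⟫_ℂ + ⟪x, z'⟫_ℂ = ⟪H1.trace P₁ y, sigmaLin d (H1.trace P₁ y')⟫_ℂ := by
  rw [H1.inner_trace hP₁, ← inner_diffExpr_add hab hP₀ hP₁, h.2, h'.2, h.1, h'.1,
    EnergySpace.inner_def, EnergySpace.inner_def, ← ℋ.inner_mulL2 (EnergySpace.toL2 ℋ x)]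
  rfl

lemma IsRep.two_mul_re_inner (hab : a < b) (hP₀ : P₀ᴴ = -P₀) (hP₁ : P₁ᴴ = P₁)
    {x z : EnergySpace ℋ} {y : H1 d a b} (h : IsRep P₀ P₁ x z y) :
    2 * (⟪z, x⟫_ℂ).re = (⟪H1.trace P₁ y, sigmaLin d (H1.trace P₁ y)⟫_ℂ).re := by
  rw [← h.inner_add hab hP₀ hP₁ h, Complex.add_re, ← inner_conj_symm x z, Complex.conj_re, two_mul]

/-- The adjoint of A₀ is minus the maximal operator; `exists_diffExpr_eq` is carried over to X,
where every `H1` function has the form `ℋx'`. -/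
lemma exists_isRep_of_weak (hab : a < b) (hP₀ : P₀ᴴ = -P₀) (hP₁ : P₁ᴴ = P₁) (hP₁' : IsUnit P₁)
    (x z : EnergySpace ℋ)
    (h : ∀ x' z' y', IsRep P₀ P₁ (ℋ := ℋ) x' z' y' → y' ∈ zeroBoundary d a b →
      ⟪z, x'⟫_ℂ + ⟪x, z'⟫_ℂ = 0) :
    ∃ y, IsRep P₀ P₁ x z y := by
  refine exists_diffExpr_eq hab hP₀ hP₁ hP₁' _ _ fun w hw => ?_
  obtain ⟨x', z', hr⟩ := exists_isRep P₀ P₁ ℋ w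
  have h1 := h x' z' w hr hw
  rw [EnergySpace.inner_def, EnergySpace.inner_def, ← ℋ.inner_mulL2 (EnergySpace.toL2 ℋ x)] at h1
  rw [hr.1, hr.2]
  exact h1

/-- The graph of the operator with boundary condition `trace ∈ K` is determined by its formal
adjoint. -/
lemma mem_graph_comap_trace_iff (hab : a < b) (hP₀ : P₀ᴴ = -P₀) (hP₁ : P₁ᴴ = P₁)
    (hP₁' : IsUnit P₁) (K : Submodule ℂ (Vec2 d)) (x z : EnergySpace ℋ) :
    (x, z) ∈ (phOperator P₀ P₁ ℋ (K.comap (H1.trace P₁))).graph ↔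
      ∀ x' z' y', IsRep P₀ P₁ (ℋ := ℋ) x' z' y' →
        (∀ k ∈ K, ⟪k, sigmaLin d (H1.trace P₁ y')⟫_ℂ = 0) → ⟪z, x'⟫_ℂ + ⟪x, z'⟫_ℂ = 0 := by
  rw [mem_phOperator_graph]
  constructor
  · rintro ⟨y, hy, hr⟩ x' z' y' hr' hK
    rw [hr.inner_add hab hP₀ hP₁ hr']
    exact hK _ hy
  · intro h
    obtain ⟨y, hr⟩ := exists_isRep_of_weak hab hP₀ hP₁ hP₁' x z fun x' z' y' hr' hy' =>
      h x' z' y' hr' fun k _ => by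
        rw [(H1.trace_eq_zero_iff hP₁' y').2 hy', map_zero, inner_zero_right]
    refine ⟨y, ?_, hr⟩
    -- Membership of the trace in K is tested against u orthogonal to K, using a y' with trace Σu.
    rw [Submodule.mem_comap, ← K.orthogonal_orthogonal, Submodule.mem_orthogonal']
    intro u hu
    obtain ⟨y', hy'⟩ := H1.trace_surjective (a := a) (b := b) hab hP₁' (sigmaLin d u)
    obtain ⟨x', z', hr'⟩ := exists_isRep P₀ P₁ ℋ y'
    have h1 := h x' z' y' hr' fun k hk => by
      rw [hy', sigmaLin_sigmaLin]; exact (Submodule.mem_orthogonal _ _).1 hu k hk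
    rw [hr.inner_add hab hP₀ hP₁ hr', hy', sigmaLin_sigmaLin] at h1
    exact h1

/-- The weak description writes the graph as an intersection of zero sets of continuous functions.
-/
lemma isClosed_graph_comap_trace (hab : a < b) (hP₀ : P₀ᴴ = -P₀) (hP₁ : P₁ᴴ = P₁)
    (hP₁' : IsUnit P₁) (K : Submodule ℂ (Vec2 d)) :
    IsClosed ((phOperator P₀ P₁ ℋ (K.comap (H1.trace P₁))).graph :
      Set (EnergySpace ℋ × EnergySpace ℋ)) := by
  have h : ((phOperator P₀ P₁ ℋ (K.comap (H1.trace P₁))).graph :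
      Set (EnergySpace ℋ × EnergySpace ℋ)) =
      ⋂ (x' : EnergySpace ℋ) (z' : EnergySpace ℋ) (y' : H1 d a b) (_ : IsRep P₀ P₁ x' z' y')
        (_ : ∀ k ∈ K, ⟪k, sigmaLin d (H1.trace P₁ y')⟫_ℂ = 0),
        {p | ⟪p.2, x'⟫_ℂ + ⟪p.1, z'⟫_ℂ = 0} := by
    ext ⟨x, z⟩
    simp only [mem_iInter]
    exact mem_graph_comap_trace_iff hab hP₀ hP₁ hP₁' K x z
  rw [h]
  refine isClosed_iInter fun x' => isClosed_iInter fun z' => isClosed_iInter fun y' =>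
    isClosed_iInter fun _ => isClosed_iInter fun _ => isClosed_eq ?_ continuous_const
  fun_prop

lemma phOperator_isDissipative (hab : a < b) (hP₀ : P₀ᴴ = -P₀) (hP₁ : P₁ᴴ = P₁)
    {K : Submodule ℂ (Vec2 d)} (hK : ∀ k ∈ K, (⟪k, sigmaLin d k⟫_ℂ).re ≤ 0) :
    (phOperator P₀ P₁ ℋ (K.comap (H1.trace P₁))).IsDissipative := fun x => by
  obtain ⟨y, hy, hr⟩ := mem_phOperator_graph.1 (LinearPMap.mem_graph _ x)
  have h1 := hr.two_mul_re_inner hab hP₀ hP₁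
  have h2 := hK _ hy
  linarith

/-- Dissipative boundary conditions given by an admissible matrix lead to a generator. -/
lemma generates_opB₀ (hab : a < b) (hP₀ : P₀ᴴ = -P₀) (hP₁ : P₁ᴴ = P₁) (hP₁' : IsUnit P₁)
    {W : Matrix (Fin d) (Fin d ⊕ Fin d) ℂ} (hW : Admissible W) :
    GeneratesContractionSemigroup (opB₀ P₀ P₁ ℋ W) := by
  rw [opB₀, boundaryCondition_eq]
  set K := LinearMap.ker (Matrix.toEuclideanLin W) with hKdef
  have hdiss := phOperator_isDissipative (ℋ := ℋ) hab hP₀ hP₁ (K := K) fun k hk => hW.nonpos hk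
  refine hdiss.generatesContractionSemigroup fun c hc => hdiss.surjective_of_isClosed
    (isClosed_graph_comap_trace hab hP₀ hP₁ hP₁' K) hc fun v hv => ?_
  -- Orthogonality to the range of c - B says weakly that (v, -cv) is a pair of the maximal operator
  -- whose trace is Σ-orthogonal to K. The form is nonnegative there, so -2c‖v‖² ≥ 0.
  have hv' : ∀ x' z' y', IsRep P₀ P₁ (ℋ := ℋ) x' z' y' → H1.trace P₁ y' ∈ K →
      ⟪-((c : ℂ) • v), x'⟫_ℂ + ⟪v, z'⟫_ℂ = 0 := fun x' z' y' hr hy' => by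
    have h1 := hv x' z' (mem_phOperator_graph.2 ⟨y', hy', hr⟩)
    rw [inner_sub_right, inner_smul_right] at h1
    rw [inner_neg_left, inner_smul_left, Complex.conj_ofReal]
    linear_combination -h1
  obtain ⟨y, hr⟩ := exists_isRep_of_weak hab hP₀ hP₁ hP₁' v (-((c : ℂ) • v))
    fun x' z' y' hr' hy' => hv' x' z' y' hr' (by
      rw [(H1.trace_eq_zero_iff hP₁' y').2 hy']; exact K.zero_mem)
  have horth : sigmaLin d (H1.trace P₁ y) ∈ Kᗮ := by
    refine (Submodule.mem_orthogonal' _ _).2 fun k hk => ?_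
    obtain ⟨y', rfl⟩ := H1.trace_surjective (a := a) (b := b) hab hP₁' k
    obtain ⟨x', z', hr'⟩ := exists_isRep P₀ P₁ ℋ y'
    rw [inner_sigmaLin_left, ← hr.inner_add hab hP₀ hP₁ hr']
    exact hv' x' z' y' hr' hk
  have h1 := hW.nonneg horth
  rw [inner_sigmaLin_sigmaLin, ← hr.two_mul_re_inner hab hP₀ hP₁, inner_neg_left,
    inner_smul_left, Complex.conj_ofReal, Complex.neg_re, Complex.re_ofReal_mul] at h1
  refine eq_zero_of_re_inner_self_nonpos (nonpos_of_mul_nonpos_right ?_ hc)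
  linarith

/-- Dissipative extensions of the minimal operator are restrictions of the maximal operator. -/
lemma exists_isRep_of_isDissipative (hab : a < b) (hP₀ : P₀ᴴ = -P₀) (hP₁ : P₁ᴴ = P₁)
    (hP₁' : IsUnit P₁) {B : EnergySpace ℋ →ₗ.[ℂ] EnergySpace ℋ} (hAB : opA₀ P₀ P₁ ℋ ≤ B)
    (hB : B.IsDissipative) {x z : EnergySpace ℋ} (hxz : (x, z) ∈ B.graph) :
    ∃ y, IsRep P₀ P₁ x z y := by
  have hdiss : ∀ {x z : EnergySpace ℋ}, (x, z) ∈ B.graph → (⟪z, x⟫_ℂ).re ≤ 0 := fun h => by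
    obtain ⟨u, hu, hu'⟩ := B.mem_graph_iff.1 h
    simp only at hu hu'
    rw [← hu, ← hu']
    exact hB u
  refine exists_isRep_of_weak hab hP₀ hP₁ hP₁' x z fun x' z' y' hr' hy' => ?_
  have hmem : (x', z') ∈ B.graph :=
    LinearPMap.le_graph_of_le hAB (mem_phOperator_graph.2 ⟨y', hy', hr'⟩)
  have h0 : (⟪z', x'⟫_ℂ).re = 0 := by
    have h1 := hr'.two_mul_re_inner hab hP₀ hP₁
    rw [(H1.trace_eq_zero_iff hP₁' y').2 hy', map_zero, inner_zero_right, Complex.zero_re] at h1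
    linarith
  set s : ℂ := ⟪z, x'⟫_ℂ + ⟪x, z'⟫_ℂ with hs
  -- Dissipativity is applied to (x, z) + c(x', z') with c = t·conj(s). The quadratic term drops out
  -- by `h0`, and an expression affine in t is bounded above for all real t only if its slope |s|²
  -- vanishes.
  have hmain : ∀ t : ℝ, (⟪z, x⟫_ℂ).re + t * Complex.normSq s ≤ 0 := by
    intro t
    set c : ℂ := (t : ℂ) * (starRingEnd ℂ) s with hc
    have h1 := hdiss (B.graph.add_mem hxz (B.graph.smul_mem c hmem))
    have h2 : (⟪z + c • z', x + c • x'⟫_ℂ).re = (⟪z, x⟫_ℂ).re + (c * s).re +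
        Complex.normSq c * (⟪z', x'⟫_ℂ).re := by
      have h3 : ⟪z + c • z', x + c • x'⟫_ℂ = ⟪z, x⟫_ℂ + c * ⟪z, x'⟫_ℂ +
          (starRingEnd ℂ) (c * ⟪x, z'⟫_ℂ) + (Complex.normSq c : ℂ) * ⟪z', x'⟫_ℂ := by
        rw [inner_add_left, inner_add_right, inner_add_right, inner_smul_left, inner_smul_left,
          inner_smul_right, inner_smul_right, map_mul (starRingEnd ℂ) c ⟪x, z'⟫_ℂ, inner_conj_symm,
          Complex.normSq_eq_conj_mul_self]
        ring
      rw [h3, Complex.add_re, Complex.add_re, Complex.add_re, Complex.conj_re,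
        Complex.re_ofReal_mul, hs, mul_add, Complex.add_re]
      ring
    have h4 : c * s = ((t * Complex.normSq s : ℝ) : ℂ) := by
      rw [hc, mul_assoc, ← Complex.normSq_eq_conj_mul_self, Complex.ofReal_mul]
    change (⟪z + c • z', x + c • x'⟫_ℂ).re ≤ 0 at h1
    rw [h2, h0, h4, Complex.ofReal_re, mul_zero, add_zero] at h1
    exact h1
  by_contra hne
  have hpos := Complex.normSq_pos.2 hne
  have h1 := hmain ((1 - (⟪z, x⟫_ℂ).re) / Complex.normSq s)
  rw [div_mul_cancel₀ _ hpos.ne'] at h1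
  linarith

/-- The boundary values of the elements of the domain of `B`. -/
def boundarySpace (P₀ P₁ : Matrix (Fin d) (Fin d) ℂ)
    (B : EnergySpace ℋ →ₗ.[ℂ] EnergySpace ℋ) : Submodule ℂ (Vec2 d) where
  carrier := {k | ∃ x z y, (x, z) ∈ B.graph ∧ IsRep P₀ P₁ x z y ∧ H1.trace P₁ y = k}
  add_mem' := by
    rintro _ _ ⟨x, z, y, h, hr, rfl⟩ ⟨x', z', y', h', hr', rfl⟩
    exact ⟨x + x', z + z', y + y', B.graph.add_mem h h', hr.add hr', map_add _ _ _⟩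
  zero_mem' := ⟨0, 0, 0, B.graph.zero_mem, by simp [IsRep], map_zero _⟩
  smul_mem' := by
    rintro c _ ⟨x, z, y, h, hr, rfl⟩
    exact ⟨c • x, c • z, c • y, B.graph.smul_mem c h, hr.smul c, map_smul _ _ _⟩

/-- Two pairs with the same trace differ by an element of the graph of A₀, which B contains; hence
the boundary values alone decide membership in B. -/
lemma eq_phOperator_boundarySpace (hab : a < b) (hP₀ : P₀ᴴ = -P₀) (hP₁ : P₁ᴴ = P₁)
    (hP₁' : IsUnit P₁) {B : EnergySpace ℋ →ₗ.[ℂ] EnergySpace ℋ} (hAB : opA₀ P₀ P₁ ℋ ≤ B)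
    (hB : B.IsDissipative) :
    B = phOperator P₀ P₁ ℋ ((boundarySpace P₀ P₁ B).comap (H1.trace P₁)) := by
  refine LinearPMap.eq_of_eq_graph (Submodule.ext ?_)
  rintro ⟨x, z⟩
  constructor
  · intro h
    obtain ⟨y, hr⟩ := exists_isRep_of_isDissipative hab hP₀ hP₁ hP₁' hAB hB h
    exact mem_phOperator_graph.2 ⟨y, ⟨x, z, y, h, hr, rfl⟩, hr⟩
  · intro h
    obtain ⟨y, ⟨x₁, z₁, y₁, h₁, hr₁, hy₁⟩, hr⟩ := mem_phOperator_graph.1 h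
    have h0 : y - y₁ ∈ zeroBoundary d a b := by
      rw [← H1.trace_eq_zero_iff hP₁', map_sub, hy₁, sub_self]
    have h2 : (x - x₁, z - z₁) ∈ B.graph :=
      LinearPMap.le_graph_of_le hAB (mem_phOperator_graph.2 ⟨y - y₁, h0, hr.sub hr₁⟩)
    have h3 := B.graph.add_mem h2 h₁
    rwa [Prod.mk_add_mk, sub_add_cancel, sub_add_cancel] at h3

lemma exists_admissible_of_generates (hab : a < b) (hP₀ : P₀ᴴ = -P₀) (hP₁ : P₁ᴴ = P₁)
    (hP₁' : IsUnit P₁) {B : EnergySpace ℋ →ₗ.[ℂ] EnergySpace ℋ} (hAB : opA₀ P₀ P₁ ℋ ≤ B)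
    (hgen : GeneratesContractionSemigroup B) :
    ∃ W : Matrix (Fin d) (Fin d ⊕ Fin d) ℂ, Admissible W ∧ B = opB₀ P₀ P₁ ℋ W := by
  obtain ⟨T, hT, hBT⟩ := hgen
  have hB := hBT.isDissipative hT
  have hK : ∀ k ∈ boundarySpace P₀ P₁ B, (⟪k, sigmaLin d k⟫_ℂ).re ≤ 0 := by
    rintro _ ⟨x, z, y, h, hr, rfl⟩
    obtain ⟨u, hu, hu'⟩ := B.mem_graph_iff.1 h
    simp only at hu hu'
    have h1 := hB u
    rw [hu, hu'] at h1
    rw [← hr.two_mul_re_inner hab hP₀ hP₁]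
    linarith
  -- Maximality: let k be the trace of a pair (x, z) and solve u - Bu = x - z. Then z - Bu = x - u,
  -- so the form at the trace of the difference is 2‖x - u‖² ≥ 0. By Σ-orthogonality it is the form
  -- at k plus a nonpositive contribution of u, hence the form at k is nonnegative.
  obtain ⟨W, hW, hker⟩ := exists_admissible hK fun k hk => by
    obtain ⟨y, rfl⟩ := H1.trace_surjective (a := a) (b := b) hab hP₁' k
    obtain ⟨x, z, hr⟩ := exists_isRep P₀ P₁ ℋ y
    obtain ⟨u, hu⟩ := hBT.surjective_sub hT (x - z)
    obtain ⟨y', hr'⟩ := exists_isRep_of_isDissipative hab hP₀ hP₁ hP₁' hAB hB (B.mem_graph u)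
    have hky' : H1.trace P₁ y' ∈ boundarySpace P₀ P₁ B := ⟨u, B u, y', B.mem_graph u, hr', rfl⟩
    have h1 := (hr.sub hr').two_mul_re_inner hab hP₀ hP₁
    have h2 : z - B u = x - u := by
      rw [sub_eq_sub_iff_add_eq_add] at hu ⊢
      rw [add_comm z, hu]
    have h3 : 0 ≤ (⟪z - B u, x - u⟫_ℂ).re := by
      rw [h2]; exact inner_self_nonneg (𝕜 := ℂ)
    have h4 : ⟪H1.trace P₁ y, sigmaLin d (H1.trace P₁ y')⟫_ℂ = 0 := by
      rw [← inner_sigmaLin_left]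
      exact inner_eq_zero_symm.1 (hk _ hky')
    have h6 : ⟪H1.trace P₁ (y - y'), sigmaLin d (H1.trace P₁ (y - y'))⟫_ℂ =
        ⟪H1.trace P₁ y, sigmaLin d (H1.trace P₁ y)⟫_ℂ +
          ⟪H1.trace P₁ y', sigmaLin d (H1.trace P₁ y')⟫_ℂ := by
      rw [map_sub, map_sub, inner_sub_left, inner_sub_right, inner_sub_right, hk _ hky', h4]
      ring
    rw [h6, Complex.add_re] at h1
    have h5 := hK _ hky'
    linarith
  refine ⟨W, hW, ?_⟩
  rw [opB₀, boundaryCondition_eq, hker]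
  exact eq_phOperator_boundarySpace hab hP₀ hP₁ hP₁' hAB hB

lemma opA₀_le_opB₀ (hP₁' : IsUnit P₁) (W : Matrix (Fin d) (Fin d ⊕ Fin d) ℂ) :
    opA₀ P₀ P₁ ℋ ≤ opB₀ P₀ P₁ ℋ W := by
  refine phOperator_mono P₀ P₁ ℋ fun y hy => ?_
  rw [boundaryCondition_eq, Submodule.mem_comap, (H1.trace_eq_zero_iff hP₁' y).2 hy]
  exact Submodule.zero_mem _

end PHS

theorem theorem6p2 (d : ℕ) (hd : 1 ≤ d) (a b : ℝ) (hab : a < b)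
    (P₀ P₁ : Matrix (Fin d) (Fin d) ℂ) (hP₀ : P₀ᴴ = -P₀) (hP₁ : P₁ᴴ = P₁) (hP₁' : IsUnit P₁)
    (ℋ : PHS.EnergyDensity d a b) :
    (∀ W : Matrix (Fin d) (Fin d ⊕ Fin d) ℂ, PHS.Admissible W →
      PHS.opA₀ P₀ P₁ ℋ ≤ PHS.opB₀ P₀ P₁ ℋ W ∧
      PHS.GeneratesContractionSemigroup (PHS.opB₀ P₀ P₁ ℋ W)) ∧
    (∀ B : PHS.EnergySpace ℋ →ₗ.[ℂ] PHS.EnergySpace ℋ,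
      PHS.opA₀ P₀ P₁ ℋ ≤ B → PHS.GeneratesContractionSemigroup B →
      ∃ W : Matrix (Fin d) (Fin d ⊕ Fin d) ℂ, PHS.Admissible W ∧ B = PHS.opB₀ P₀ P₁ ℋ W) :=
  ⟨fun W hW => ⟨PHS.opA₀_le_opB₀ hP₁' W, PHS.generates_opB₀ hab hP₀ hP₁ hP₁' hW⟩,
    fun _ hAB hB => PHS.exists_admissible_of_generates hab hP₀ hP₁ hP₁' hAB hB⟩
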